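/- **Setting.** Fix $p\ge 1$. Along a sequence of designs (limits below are along this sequence) there are $m$ clusters of sizes $n_1,\dots,n_m$; put $N=\sum_i n_i$, $n=N/m$, $n_L=\min_i n_i$. The covariates $\boldsymbol x_{ij}\in\mathbb R^p$ ($1\le i\le m$, $1\le j\le n_i$) are non-random and enter both as fixed and as random effect covariates; $\boldsymbol X_i=[\boldsymbol x_{i1},\dots,\boldsymbol x_{in_i}]^\top$. The clusters are independent. The random effects $\dot{\boldsymbol b}_i$ are i.i.d. $N(\boldsymbol 0,\dot{\boldsymbol G})$ in $\mathbb R^p$, and given $\dot{\boldsymbol b}_i$ the responses $y_{i1},\dots,y_{in_i}$ are independent, $y_{ij}$ having density $f(y\mid\dot{\boldsymbol\beta},\dot{\boldsymbol b}_i,\dot\phi)=\exp[\dot\phi^{-1}\{y\dot\eta_{ij}-a(\dot\eta_{ij})\}+c(y,\dot\phi)]$ with respect to a fixed measure, where $\dot\eta_{ij}=\boldsymbol x_{ij}^\top\dot{\boldsymbol\beta}+\boldsymbol x_{ij}^\top\dot{\boldsymbol b}_i$, $\dot\phi>0$, and the natural parameter space is $\mathbb R$. Let $\hat{\boldsymbol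 G}$ and $\hat\phi$ be (possibly random) working quantities. The PQL estimator $\hat{\boldsymbol\theta}=(\hat{\boldsymbol\beta},\hat{\boldsymbol b}_1,\dots,\hat{\boldsymbol b}_m)$ is a random vector maximising over $\mathbb R^{(m+1)p}$ $$Q(\boldsymbol\beta,\boldsymbol b)=\sum_{i=1}^m\sum_{j=1}^{n_i}\ln f(y_{ij}\mid\boldsymbol\beta,\boldsymbol b_i,\hat\phi)-\tfrac12\sum_{i=1}^m\boldsymbol b_i^\top\hat{\boldsymbol G}^{-1}\boldsymbol b_i .$$ Write $\dot{\boldsymbol\mu}_i=(a'(\dot\eta_{ij}))_j$, $\dot{\boldsymbol W}_i=\hat\phi^{-1}\mathrm{diag}\{a''(\dot\eta_{ij})\}_j$ and $\dot{\boldsymbol H}_i=(n_i^{-1}\hat\phi\dot\phi^{-1}\boldsymbol X_i^\top\dot{\boldsymbol W}_i\boldsymbol X_i)^{-1}$. **Conditions.** * (C1) $a$ is three times continuously differentiable and, for some $c_0>0$, $c_0\le a''\le c_0^{-1}$ and $|a'''|\le c_0^{-1}$ on $\mathbb R$. * (C2) $\|\boldsymbol x_{ij}\|_\infty<C_1$ for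 all $i,j$ and a constant $C_1$. From some stage on, all the matrices $\boldsymbol X_i^\top\dot{\boldsymbol W}_i\boldsymbol X_i$ are almost surely invertible. The limits in probability $\dot{\boldsymbol K}_i=\lim\dot{\boldsymbol H}_i$ (each $i$) and $\dot{\boldsymbol K}=\lim m^{-1}\sum_{i=1}^m n\,n_i^{-1}\dot{\boldsymbol H}_i$, which may be random, exist and are almost surely positive definite with all eigenvalues in $[c_1,c_1^{-1}]$, for a constant $c_1>0$. * (C3) $(\dot{\boldsymbol\beta},\dot{\boldsymbol b}_1,\dots,\dot{\boldsymbol b}_m)$ is almost surely an interior point of some compact subset of $\mathbb R^{(m+1)p}$, which may depend on the realisation. * (C4) $\hat{\boldsymbol G}$ is positive definite with $\hat{\boldsymbol G}^{-1}=O_p(1)$; $\hat\phi>0$ and $\hat\phi=O_p(1)$. * (C5) For all $i$, every component of $n_i^{1/2}(\boldsymbol X_i^\top\dot{\boldsymbol W}_i\boldsymbol X_i+\hat{\boldsymbol G}^{-1})^{-1}\{\hat\phi^{-1}\boldsymbol X_i^\top(\boldsymbol y_i-\dot{\boldsymbol\mu}_i)-\hat{\boldsymbol G}^{-1}\dot{\boldsymbol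 b}_i\}$ has a finite fourth moment. **Theorem.** Assume (C1)–(C5), $m\to\infty$, $n_L\to\infty$, $n_i=O(n_L)$ uniformly in $i$, and $m n_L^{-2}\to0$. Let $\boldsymbol A_r$ be $q\times mp$ matrices ($q$ fixed) with the finite selection property: for each row there is an $m_0$ such that, whenever $m>m_0$, the entries of the row belonging to the clusters $i>m_0$ vanish; and every entry converges. Then, unconditionally on the random effects, with $\hat{\boldsymbol b}=(\hat{\boldsymbol b}_1^\top,\dots,\hat{\boldsymbol b}_m^\top)^\top$ and $\dot{\boldsymbol b}=(\dot{\boldsymbol b}_1^\top,\dots,\dot{\boldsymbol b}_m^\top)^\top$, $$\boldsymbol A_r(\hat{\boldsymbol b}-\dot{\boldsymbol b})\xrightarrow{P}\boldsymbol 0_q .$$ Consequently, for each fixed $i$, $\hat{\boldsymbol b}_i$ converges in distribution to $\dot{\boldsymbol b}_i\sim N(\boldsymbol 0,\dot{\boldsymbol G})$; more generally, for every finite set $s$ of clusters, $(\hat{\boldsymbol b}_i)_{i\in s}$ converges jointly in distribution to $(\dot{\boldsymbol b}_i)_{i\in s}$. -/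

import Mathlib

open MeasureTheory ProbabilityTheory Filter Topology
open scoped Matrix ENNReal

noncomputable section

namespace PQL

/-- `p`-dimensional Euclidean space. -/
abbrev Vec (p : ℕ) : Type := EuclideanSpace ℝ (Fin p)

/-- Exponential family density with natural parameter `η` and dispersion `φ`. -/
def density (a : ℝ → ℝ) (c : ℝ → ℝ → ℝ) (φ η y : ℝ) : ℝ :=
  Real.exp (φ⁻¹ * (y * η - a η) + c y φ)

/-- The response distribution: the exponential family density with respect to `ν`
(for instance Lebesgue or counting measure). -/
def responseLaw (a : ℝ → ℝ) (c : ℝ → ℝ → ℝ) (ν : Measure ℝ) (φ η : ℝ) : Measure ℝ :=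
  ν.withDensity fun y => ENNReal.ofReal (density a c φ η y)

/-- The linear predictor `xᵀβ + xᵀb`, every covariate being both a fixed and a random effect
covariate. -/
def linPred {p : ℕ} (x β b : Vec p) : ℝ := inner ℝ x β + inner ℝ x b

/-- The PQL objective function of `(β, b)`, for `m` clusters of sizes `n i`, covariates `x i j` and
responses `y i j` (`i < m`, `j < n i`), at the dispersion `φ` and random effects covariance `G`. -/
def objective {p : ℕ} (a : ℝ → ℝ) (c : ℝ → ℝ → ℝ) (φ : ℝ) (G : Matrix (Fin p) (Fin p) ℝ)
    (m : ℕ) (n : ℕ → ℕ) (x : ℕ → ℕ → Vec p) (y : ℕ → ℕ → ℝ) (θ : Vec p × (Fin m → Vec p)) : ℝ :=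
  (∑ i : Fin m, ∑ j ∈ Finset.range (n i),
      Real.log (density a c φ (linPred (x i j) θ.1 (θ.2 i)) (y i j)))
    - 1 / 2 * ∑ i : Fin m, (θ.2 i).ofLp ⬝ᵥ (G⁻¹ *ᵥ (θ.2 i).ofLp)

/-- The data of a sequence, indexed by `k`, of independent-cluster GLMMs with growing number of
clusters and cluster sizes, together with working quantities and estimators. Clusters and
measurements are numbered from `0`. Only `n k i`, `x k i j`, `y k i j` with `i < m k` and
`j < n k i` play a role at stage `k`. -/
structure GLMMSeq (p : ℕ) (Ω : Type*) where
  /-- number of clusters -/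
  m : ℕ → ℕ
  /-- cluster sizes -/
  n : ℕ → ℕ → ℕ
  /-- covariates -/
  x : ℕ → ℕ → ℕ → Vec p
  /-- cumulant function of the exponential family -/
  a : ℝ → ℝ
  /-- normalising function of the exponential family -/
  c : ℝ → ℝ → ℝ
  /-- dominating measure of the exponential family -/
  ν : Measure ℝ
  /-- true fixed effects -/
  β : Vec p
  /-- true dispersion -/
  φ : ℝ
  /-- true random effects covariance matrix -/
  G : Matrix (Fin p) (Fin p) ℝ
  /-- true realised random effects -/
  b : ℕ → Ω → Vec p
  /-- responses -/
  y : ℕ → ℕ → ℕ → Ω → ℝ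
  /-- working covariance matrix -/
  Ghat : ℕ → Ω → Matrix (Fin p) (Fin p) ℝ
  /-- working dispersion -/
  φhat : ℕ → Ω → ℝ
  /-- estimator of the fixed effects -/
  βhat : ℕ → Ω → Vec p
  /-- predictors of the random effects -/
  bhat : (k : ℕ) → Ω → Fin (m k) → Vec p

namespace GLMMSeq

variable {p : ℕ} {Ω : Type*}

/-- Minimal cluster size `n_L`. -/
def nL (S : GLMMSeq p Ω) (k : ℕ) : ℕ := ⨅ i : Fin (S.m k), S.n k i

/-- Mean cluster size `n = N / m`. -/
def nBar (S : GLMMSeq p Ω) (k : ℕ) : ℝ := (∑ i : Fin (S.m k), (S.n k i : ℝ)) / S.m k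

/-- True linear predictor of measurement `j` of cluster `i`. -/
def eta (S : GLMMSeq p Ω) (k i j : ℕ) (ω : Ω) : ℝ := linPred (S.x k i j) S.β (S.b i ω)

/-- The design matrix `X_i`. -/
def X (S : GLMMSeq p Ω) (k i : ℕ) : Matrix (Fin (S.n k i)) (Fin p) ℝ :=
  Matrix.of fun j l => S.x k i j l

/-- The weight matrix `W_i` at the true parameters. -/
def W (S : GLMMSeq p Ω) (k i : ℕ) (ω : Ω) : Matrix (Fin (S.n k i)) (Fin (S.n k i)) ℝ :=
  (S.φhat k ω)⁻¹ • Matrix.diagonal fun j : Fin (S.n k i) => iteratedDeriv 2 S.a (S.eta k i j ω)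

/-- The residual vector `y_i - μ_i` at the true parameters. -/
def resid (S : GLMMSeq p Ω) (k i : ℕ) (ω : Ω) : Fin (S.n k i) → ℝ :=
  fun j => S.y k i j ω - deriv S.a (S.eta k i j ω)

/-- The information matrix `X_iᵀ W_i X_i` at the true parameters. -/
def info (S : GLMMSeq p Ω) (k i : ℕ) (ω : Ω) : Matrix (Fin p) (Fin p) ℝ :=
  (S.X k i)ᵀ * S.W k i ω * S.X k i

/-- `H_i = (n_i⁻¹ φhat φ⁻¹ X_iᵀ W_i X_i)⁻¹`. -/
def H (S : GLMMSeq p Ω) (k i : ℕ) (ω : Ω) : Matrix (Fin p) (Fin p) ℝ :=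
  (((S.n k i : ℝ)⁻¹ * S.φhat k ω * S.φ⁻¹) • S.info k i ω)⁻¹

/-- The normalised one-step prediction error of cluster `i`:
`n_i^{1/2} (X_iᵀ W_i X_i + Ghat⁻¹)⁻¹ {φhat⁻¹ X_iᵀ (y_i - μ_i) - Ghat⁻¹ b_i}`. -/
def oneStep (S : GLMMSeq p Ω) (k i : ℕ) (ω : Ω) : Fin p → ℝ :=
  Real.sqrt (S.n k i) • ((S.info k i ω + (S.Ghat k ω)⁻¹)⁻¹ *ᵥ
    ((S.φhat k ω)⁻¹ • ((S.X k i)ᵀ *ᵥ S.resid k i ω) - (S.Ghat k ω)⁻¹ *ᵥ (S.b i ω).ofLp))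

/-- The vector of true random effects of the clusters present at stage `k`. -/
def bTrue (S : GLMMSeq p Ω) (k : ℕ) (ω : Ω) : Fin (S.m k) → Vec p := fun i => S.b i ω

/-- The predictor of the random effect of cluster `i`, set to `0` at the (finitely many, when
`m → ∞`) stages `k` at which cluster `i` is not yet present. -/
def bhatAt (S : GLMMSeq p Ω) (i k : ℕ) (ω : Ω) : Vec p :=
  if h : i < S.m k then S.bhat k ω ⟨i, h⟩ else 0

end GLMMSeq

variable {p : ℕ} {Ω : Type*} [MeasurableSpace Ω]

/-- `O_p(1)`. -/
def BoundedInProbability (μ : Measure Ω) (Z : ℕ → Ω → ℝ) : Prop :=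
  ∀ ε : ℝ≥0∞, 0 < ε → ∃ M : ℝ, ∀ᶠ k in atTop, μ {ω | M < |Z k ω|} ≤ ε

/-- The true model. The clusters are independent, the random effects are `N(0, G)`, and given the
random effect of a cluster its responses are independent with the exponential family law whose
natural parameter is the linear predictor (canonical link). -/
structure IsGLMM (S : GLMMSeq p Ω) (μ : Measure Ω) : Prop where
  measurable_c : Measurable fun y => S.c y S.φ
  isDensity : ∀ η : ℝ, ∫⁻ y, ENNReal.ofReal (density S.a S.c S.φ η y) ∂S.ν = 1
  dispersion_pos : 0 < S.φ
  cov_posSemidef : S.G.PosSemidef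
  measurable_b : ∀ i, Measurable (S.b i)
  measurable_y : ∀ k i j, Measurable (S.y k i j)
  law_b : ∀ i, μ.map (S.b i) = multivariateGaussian 0 S.G
  indep_clusters : ∀ k, iIndepFun
    (fun (i : Fin (S.m k)) (ω : Ω) =>
      ((S.b i ω, fun j => S.y k i j ω) : Vec p × (Fin (S.n k i) → ℝ))) μ
  cond_law : ∀ k, ∀ i < S.m k, ∀ B : Set (Vec p), MeasurableSet B →
    ∀ A : Fin (S.n k i) → Set ℝ, (∀ j, MeasurableSet (A j)) →
      μ {ω | S.b i ω ∈ B ∧ ∀ j : Fin (S.n k i), S.y k i j ω ∈ A j} =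
        ∫⁻ u in B, ∏ j : Fin (S.n k i),
          responseLaw S.a S.c S.ν S.φ (linPred (S.x k i j) S.β u) (A j)
          ∂(multivariateGaussian 0 S.G)

/-- `(βhat, bhat)` is the PQL estimator: a random vector that maximises the PQL objective function
at the working dispersion and covariance matrix. -/
structure IsPQLEstimator (S : GLMMSeq p Ω) (μ : Measure Ω) : Prop where
  measurable_βhat : ∀ k, Measurable (S.βhat k)
  measurable_bhat : ∀ k, Measurable (S.bhat k)
  isMax : ∀ k, ∀ᵐ ω ∂μ, ∀ θ : Vec p × (Fin (S.m k) → Vec p),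
    objective S.a S.c (S.φhat k ω) (S.Ghat k ω) (S.m k) (S.n k) (S.x k)
        (fun i j => S.y k i j ω) θ ≤
      objective S.a S.c (S.φhat k ω) (S.Ghat k ω) (S.m k) (S.n k) (S.x k)
        (fun i j => S.y k i j ω) (S.βhat k ω, S.bhat k ω)

/-- Growth of the design: `m, n_L → ∞` and `n_i = O(n_L)` uniformly in `i`. -/
structure Growth (S : GLMMSeq p Ω) : Prop where
  m_tendsto : Tendsto S.m atTop atTop
  nL_tendsto : Tendsto S.nL atTop atTop
  balanced : ∃ C : ℝ, ∀ᶠ k in atTop, ∀ i < S.m k, (S.n k i : ℝ) ≤ C * S.nL k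

/-- (C1) -/
def CondC1 (S : GLMMSeq p Ω) : Prop :=
  ContDiff ℝ 3 S.a ∧ ∃ c₀ : ℝ, 0 < c₀ ∧ ∀ η : ℝ,
    c₀ ≤ iteratedDeriv 2 S.a η ∧ iteratedDeriv 2 S.a η ≤ c₀⁻¹ ∧ |iteratedDeriv 3 S.a η| ≤ c₀⁻¹

/-- (C2). The matrices `H_i` depend on the random effects, so that their limits may be random and
are taken in probability. -/
structure CondC2 (S : GLMMSeq p Ω) (μ : Measure Ω) : Prop where
  bounded : ∃ C₁ : ℝ, ∀ k, ∀ i < S.m k, ∀ j < S.n k i, ∀ l, |S.x k i j l| < C₁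
  isUnit_info : ∀ᶠ k in atTop, ∀ i < S.m k, ∀ᵐ ω ∂μ, IsUnit (S.info k i ω)
  limits : ∃ (Kc : ℕ → Ω → Matrix (Fin p) (Fin p) ℝ) (K : Ω → Matrix (Fin p) (Fin p) ℝ) (c₁ : ℝ),
    0 < c₁ ∧
    (∀ i l l', TendstoInMeasure μ (fun k ω => S.H k i ω l l') atTop (fun ω => Kc i ω l l')) ∧
    (∀ l l', TendstoInMeasure μ
      (fun k ω => (S.m k : ℝ)⁻¹ *
        ∑ i : Fin (S.m k), S.nBar k * (S.n k i : ℝ)⁻¹ * S.H k i ω l l') atTop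
      (fun ω => K ω l l')) ∧
    (∀ i, ∀ᵐ ω ∂μ, (Kc i ω).PosDef ∧ spectrum ℝ (Kc i ω) ⊆ Set.Icc c₁ c₁⁻¹) ∧
    (∀ᵐ ω ∂μ, (K ω).PosDef ∧ spectrum ℝ (K ω) ⊆ Set.Icc c₁ c₁⁻¹)

/-- (C3) -/
def CondC3 (S : GLMMSeq p Ω) (μ : Measure Ω) : Prop :=
  ∀ k, ∀ᵐ ω ∂μ, ∃ Θ : Set (Vec p × (Fin (S.m k) → Vec p)),
    IsCompact Θ ∧ (S.β, S.bTrue k ω) ∈ interior Θ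

/-- (C4) -/
structure CondC4 (S : GLMMSeq p Ω) (μ : Measure Ω) : Prop where
  measurable_Ghat : ∀ k l l', Measurable fun ω => S.Ghat k ω l l'
  measurable_φhat : ∀ k, Measurable (S.φhat k)
  posDef : ∀ k, ∀ᵐ ω ∂μ, (S.Ghat k ω).PosDef
  inv_bounded : ∀ l l', BoundedInProbability μ fun k ω => (S.Ghat k ω)⁻¹ l l'
  φhat_pos : ∀ k, ∀ᵐ ω ∂μ, 0 < S.φhat k ω
  φhat_bounded : BoundedInProbability μ S.φhat

/-- (C5) -/
def CondC5 (S : GLMMSeq p Ω) (μ : Measure Ω) : Prop :=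
  ∀ k, ∀ i < S.m k, ∀ l, Integrable (fun ω => S.oneStep k i ω l ^ 4) μ

/-- The finite selection property of the matrices `A_r`, of size `q × (m k) p`: each row involves
only finitely many clusters, the same ones for all `k`, and each entry has a limit. -/
structure FiniteSelection {q : ℕ} (m : ℕ → ℕ)
    (A : (k : ℕ) → Matrix (Fin q) (Fin (m k) × Fin p) ℝ) : Prop where
  finite : ∀ r, ∃ m₀ : ℕ, ∀ k, m₀ < m k → ∀ i : Fin (m k), m₀ ≤ (i : ℕ) → ∀ l, A k r (i, l) = 0
  limit : ∀ r (i : ℕ) l, ∃ L : ℝ,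
    Tendsto (fun k => if h : i < m k then A k r (⟨i, h⟩, l) else 0) atTop (𝓝 L)

end PQL

end

/-! The likelihood depends on `(β, b_1, …, b_m)` only through the sums `β + b_i`, because every
covariate is both a fixed and a random effect covariate. Moving a common vector from the predictors
to `β` therefore changes the penalty alone, and at a maximiser this forces `∑ bhat_i = 0`. The
stationarity equation in `b_i`, the strong convexity of `a` and the lower bound that (C2) gives for
`n_i⁻¹ X_iᵀ X_i` bound the error of `βhat + bhat_i` by the mean score of cluster `i` plus the
penalty, which is `O_p(1)` against the `n_i` measurements of the cluster. Averaged over the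
clusters, these errors leave `βhat - β` equal to the mean of the true random effects up to a
vanishing term, and that mean tends to zero because the random effects are centred and independent.
Hence `bhat_i - b_i` tends to zero in probability. -/

noncomputable section

namespace PQL

section SecondMoments

variable {Ω E ι : Type*} [MeasurableSpace Ω] {μ : Measure Ω} [NormedAddCommGroup E]

lemma eLpNorm_two_sq_eq_lintegral (f : Ω → E) : eLpNorm f 2 μ ^ 2 = ∫⁻ ω, ‖f ω‖ₑ ^ 2 ∂μ := by
  simpa using eLpNorm_nnreal_pow_eq_lintegral (f := f) (μ := μ) (p := 2) (by norm_num)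

lemma eLpNorm_two_le_of_lintegral_le {f : Ω → E} {V : ℝ}
    (h : ∫⁻ ω, ‖f ω‖ₑ ^ 2 ∂μ ≤ ENNReal.ofReal V) : eLpNorm f 2 μ ≤ ENNReal.ofReal √V := by
  rw [← ENNReal.pow_le_pow_left_iff two_ne_zero, eLpNorm_two_sq_eq_lintegral,
    ← ENNReal.ofReal_pow (Real.sqrt_nonneg V)]
  exact h.trans (ENNReal.ofReal_le_ofReal (Real.sqrt_le_iff.1 le_rfl).2)

lemma lintegral_enorm_sq_eq_ofReal {f : Ω → E} (hf : MemLp f 2 μ) :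
    ∫⁻ ω, ‖f ω‖ₑ ^ 2 ∂μ = ENNReal.ofReal (∫ ω, ‖f ω‖ ^ 2 ∂μ) := by
  rw [ofReal_integral_eq_lintegral_ofReal (hf.integrable_norm_pow two_ne_zero)
    (ae_of_all _ fun _ => sq_nonneg _)]
  simp only [ENNReal.ofReal_pow (norm_nonneg _), ofReal_norm]

lemma eLpNorm_two_sum_smul_le [NormedSpace ℝ E] {s : Finset ι} {w : ι → ℝ} {Y : ι → Ω → E} {Q : ℝ}
    (hw : ∀ i ∈ s, 0 ≤ w i) (hY : ∀ i ∈ s, AEStronglyMeasurable (Y i) μ)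
    (hQ : ∀ i ∈ s, eLpNorm (Y i) 2 μ ≤ ENNReal.ofReal Q) :
    eLpNorm (∑ i ∈ s, w i • Y i) 2 μ ≤ ENNReal.ofReal ((∑ i ∈ s, w i) * Q) := by
  calc eLpNorm (∑ i ∈ s, w i • Y i) 2 μ
      ≤ ∑ i ∈ s, eLpNorm (w i • Y i) 2 μ :=
        eLpNorm_sum_le (fun i hi => (hY i hi).const_smul _) (by norm_num)
    _ ≤ ∑ i ∈ s, ENNReal.ofReal (w i) * ENNReal.ofReal Q := by
        refine Finset.sum_le_sum fun i hi => ?_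
        rw [eLpNorm_const_smul, Real.enorm_of_nonneg (hw i hi)]
        gcongr
        exact hQ i hi
    _ = ENNReal.ofReal ((∑ i ∈ s, w i) * Q) := by
        rw [← Finset.sum_mul, ← ENNReal.ofReal_sum_of_nonneg hw,
          ENNReal.ofReal_mul (Finset.sum_nonneg hw)]

variable [InnerProductSpace ℝ E] [CompleteSpace E] [MeasurableSpace E] [BorelSpace E]

lemma integral_inner_eq_zero_of_indepFun {X Y : Ω → E} (hXY : X ⟂ᵢ[μ] Y) (hX : Integrable X μ)
    (hY : Integrable Y μ) (h0 : ∫ ω, X ω ∂μ = 0) : ∫ ω, inner ℝ (X ω) (Y ω) ∂μ = 0 := by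
  calc ∫ ω, inner ℝ (X ω) (Y ω) ∂μ
      = inner ℝ (∫ ω, X ω ∂μ) (∫ ω, Y ω ∂μ) := hXY.integral_bilin hX hY (innerSL ℝ)
    _ = 0 := by rw [h0, inner_zero_left]

lemma integral_norm_sq_sum_of_pairwise_indepFun [IsFiniteMeasure μ] {s : Finset ι} {Y : ι → Ω → E}
    (hY : ∀ i ∈ s, MemLp (Y i) 2 μ) (hind : Set.Pairwise s fun i j => Y i ⟂ᵢ[μ] Y j)
    (h0 : ∀ i ∈ s, ∫ ω, Y i ω ∂μ = 0) :
    ∫ ω, ‖∑ i ∈ s, Y i ω‖ ^ 2 ∂μ = ∑ i ∈ s, ∫ ω, ‖Y i ω‖ ^ 2 ∂μ := by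
  have hint : ∀ i ∈ s, ∀ j ∈ s, Integrable (fun ω => inner ℝ (Y i ω) (Y j ω)) μ :=
    fun i hi j hj => memLp_one_iff_integrable.1 ((innerSL ℝ).memLp_of_bilin 1 (hY i hi) (hY j hj))
  simp_rw [← real_inner_self_eq_norm_sq, sum_inner, inner_sum]
  rw [integral_finsetSum _ fun i hi => integrable_finsetSum _ fun j hj => hint i hi j hj]
  refine Finset.sum_congr rfl fun i hi => ?_
  rw [integral_finsetSum _ fun j hj => hint i hi j hj]
  refine Finset.sum_eq_single_of_mem i hi fun j hj hji => ?_
  exact integral_inner_eq_zero_of_indepFun (hind hi hj hji.symm)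
    ((hY i hi).integrable (by norm_num)) ((hY j hj).integrable (by norm_num)) (h0 i hi)

end SecondMoments

section ExponentialFamily

variable {a : ℝ → ℝ} {c : ℝ → ℝ → ℝ} {ν : Measure ℝ} {φ : ℝ}

/-- The functions `density a c φ η` form an exponential dispersion family with dispersion `φ`
whose natural parameter space is all of `ℝ`. -/
structure IsDispersionFamily (a : ℝ → ℝ) (c : ℝ → ℝ → ℝ) (ν : Measure ℝ) (φ : ℝ) : Prop where
  dispersion_pos : 0 < φ
  measurable_normaliser : Measurable fun y => c y φ
  lintegral_density : ∀ η : ℝ, ∫⁻ y, ENNReal.ofReal (density a c φ η y) ∂ν = 1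

lemma density_pos (η y : ℝ) : 0 < density a c φ η y := Real.exp_pos _

lemma hasDerivAt_comp_affine {g : ℝ → ℝ} (hg : Differentiable ℝ g) (η r t : ℝ) :
    HasDerivAt (fun t => g (η + r * t)) (deriv g (η + r * t) * r) t := by
  have h : HasDerivAt (fun t : ℝ => η + r * t) r t := by
    simpa using ((hasDerivAt_id t).const_mul r).const_add η
  exact (hg (η + r * t)).hasDerivAt.comp t h

namespace IsDispersionFamily

lemma measurable_density (h : IsDispersionFamily a c ν φ) (η : ℝ) :
    Measurable (density a c φ η) := by
  have := h.measurable_normaliser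
  unfold density
  fun_prop

lemma measurable_density_uncurry (h : IsDispersionFamily a c ν φ) (ha : Measurable a) :
    Measurable fun z : ℝ × ℝ => density a c φ z.1 z.2 := by
  have hc := h.measurable_normaliser
  unfold density
  fun_prop

-- `ν` is recovered from a probability measure by dividing out its positive finite density.
lemma sigmaFinite (h : IsDispersionFamily a c ν φ) : SigmaFinite ν := by
  have hm : Measurable fun y => ENNReal.ofReal (density a c φ 0 y) :=
    (h.measurable_density 0).ennreal_ofReal
  have hfin : IsFiniteMeasure (ν.withDensity fun y => ENNReal.ofReal (density a c φ 0 y)) :=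
    isFiniteMeasure_withDensity (by simp [h.lintegral_density])
  rw [← withDensity_inv_same (μ := ν) hm (by simp [density_pos]) (by simp)]
  exact SigmaFinite.withDensity_of_ne_top (by simp [density_pos])

lemma isProbabilityMeasure (h : IsDispersionFamily a c ν φ) (η : ℝ) :
    IsProbabilityMeasure (responseLaw a c ν φ η) :=
  ⟨by rw [responseLaw, withDensity_apply _ MeasurableSet.univ, Measure.restrict_univ,
    h.lintegral_density]⟩

lemma measurable_responseLaw (h : IsDispersionFamily a c ν φ) (ha : Measurable a) {s : Set ℝ}
    (hs : MeasurableSet s) : Measurable fun η => responseLaw a c ν φ η s := by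
  have := h.sigmaFinite
  simp only [responseLaw, withDensity_apply _ hs]
  exact (h.measurable_density_uncurry ha).ennreal_ofReal.lintegral_prod_right'

lemma density_mul_exp (h : IsDispersionFamily a c ν φ) (η t y : ℝ) :
    density a c φ η y * Real.exp (t * y) =
      Real.exp (φ⁻¹ * (a (η + φ * t) - a η)) * density a c φ (η + φ * t) y := by
  have := h.dispersion_pos.ne'
  simp only [density, ← Real.exp_add]
  congr 1
  field_simp
  ring

lemma lintegral_exp_mul (h : IsDispersionFamily a c ν φ) (η t : ℝ) :
    ∫⁻ y, ENNReal.ofReal (Real.exp (t * y)) ∂responseLaw a c ν φ η =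
      ENNReal.ofReal (Real.exp (φ⁻¹ * (a (η + φ * t) - a η))) := by
  rw [responseLaw, lintegral_withDensity_eq_lintegral_mul _
    (h.measurable_density η).ennreal_ofReal (by fun_prop)]
  simp only [Pi.mul_apply, ← ENNReal.ofReal_mul (density_pos _ _).le, h.density_mul_exp η t,
    ENNReal.ofReal_mul (Real.exp_pos _).le]
  rw [lintegral_const_mul _ (h.measurable_density _).ennreal_ofReal, h.lintegral_density, mul_one]

lemma integrable_exp_mul (h : IsDispersionFamily a c ν φ) (η t : ℝ) :
    Integrable (fun y => Real.exp (t * y)) (responseLaw a c ν φ η) := by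
  refine ⟨by fun_prop, ?_⟩
  rw [hasFiniteIntegral_iff_ofReal (ae_of_all _ fun _ => (Real.exp_pos _).le),
    h.lintegral_exp_mul]
  exact ENNReal.ofReal_lt_top

lemma cgf_responseLaw (h : IsDispersionFamily a c ν φ) (η : ℝ) :
    cgf id (responseLaw a c ν φ η) = fun t => φ⁻¹ * (a (η + φ * t) - a η) := by
  ext t
  rw [cgf, mgf, integral_eq_lintegral_of_nonneg_ae (ae_of_all _ fun _ => (Real.exp_pos _).le)
    (by fun_prop)]
  simp only [id]
  rw [h.lintegral_exp_mul, ENNReal.toReal_ofReal (Real.exp_pos _).le, Real.log_exp]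

lemma zero_mem_interior_integrableExpSet (h : IsDispersionFamily a c ν φ) (η : ℝ) :
    0 ∈ interior (integrableExpSet id (responseLaw a c ν φ η)) := by
  have : integrableExpSet id (responseLaw a c ν φ η) = Set.univ :=
    Set.eq_univ_of_forall (h.integrable_exp_mul η)
  simp [this]

lemma memLp_id (h : IsDispersionFamily a c ν φ) (η : ℝ) : MemLp id 2 (responseLaw a c ν φ η) := by
  exact_mod_cast memLp_of_mem_interior_integrableExpSet (h.zero_mem_interior_integrableExpSet η) 2

lemma deriv_cgf_responseLaw (h : IsDispersionFamily a c ν φ) (ha : Differentiable ℝ a) (η : ℝ) :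
    deriv (cgf id (responseLaw a c ν φ η)) = fun t => deriv a (η + φ * t) := by
  have := h.dispersion_pos.ne'
  ext t
  rw [h.cgf_responseLaw,
    (((hasDerivAt_comp_affine ha η φ t).sub_const (a η)).const_mul φ⁻¹).deriv]
  field_simp

lemma integral_id (h : IsDispersionFamily a c ν φ) (ha : Differentiable ℝ a) (η : ℝ) :
    ∫ y, y ∂responseLaw a c ν φ η = deriv a η := by
  have := h.isProbabilityMeasure η
  simpa [h.deriv_cgf_responseLaw ha] using
    (deriv_cgf_zero (h.zero_mem_interior_integrableExpSet η)).symm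

lemma variance_id (h : IsDispersionFamily a c ν φ) (ha : ContDiff ℝ 2 a) (η : ℝ) :
    Var[id; responseLaw a c ν φ η] = φ * iteratedDeriv 2 a η := by
  have hd : Differentiable ℝ (deriv a) :=
    (ContDiff.iterate_deriv' 1 1 (by simpa using ha)).differentiable (by norm_num)
  have := h.isProbabilityMeasure η
  have hvar := variance_tilted_mul (h.zero_mem_interior_integrableExpSet η)
  rw [iteratedDeriv_succ, iteratedDeriv_one,
    h.deriv_cgf_responseLaw (ha.differentiable (by norm_num)),
    (hasDerivAt_comp_affine hd η φ 0).deriv] at hvar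
  rw [iteratedDeriv_succ, iteratedDeriv_one, mul_comm]
  simpa using hvar

lemma integral_sub_mean (h : IsDispersionFamily a c ν φ) (ha : Differentiable ℝ a) (η : ℝ) :
    ∫ y, (y - deriv a η) ∂responseLaw a c ν φ η = 0 := by
  have := h.isProbabilityMeasure η
  have hi : Integrable (fun y : ℝ => y) (responseLaw a c ν φ η) :=
    (h.memLp_id η).integrable (by norm_num)
  rw [integral_sub hi (integrable_const _), h.integral_id ha]
  simp

lemma integral_sub_mean_sq (h : IsDispersionFamily a c ν φ) (ha : ContDiff ℝ 2 a) (η : ℝ) :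
    ∫ y, (y - deriv a η) ^ 2 ∂responseLaw a c ν φ η = φ * iteratedDeriv 2 a η := by
  rw [← h.variance_id ha, variance_eq_integral aemeasurable_id]
  simp only [id, h.integral_id (ha.differentiable (by norm_num))]

variable {E ι : Type*} [Fintype ι] [NormedAddCommGroup E] [InnerProductSpace ℝ E]

lemma memLp_residual_smul (h : IsDispersionFamily a c ν φ) (η : ι → ℝ) (x : ι → E) (j : ι) :
    MemLp (fun z : ι → ℝ => (z j - deriv a (η j)) • x j) 2
      (Measure.pi fun j => responseLaw a c ν φ (η j)) := by
  have := fun j => h.isProbabilityMeasure (η j)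
  have hz : MemLp (fun z : ι → ℝ => z j - deriv a (η j)) 2
      (Measure.pi fun j => responseLaw a c ν φ (η j)) :=
    ((h.memLp_id (η j)).sub (memLp_const _)).comp_measurePreserving (measurePreserving_eval _ j)
  exact (ContinuousLinearMap.toSpanSingleton ℝ (x j)).comp_memLp' hz

lemma integral_norm_sq_sum_residual_smul [CompleteSpace E] (h : IsDispersionFamily a c ν φ)
    (ha : ContDiff ℝ 2 a) (η : ι → ℝ) (x : ι → E) :
    ∫ z : ι → ℝ, ‖∑ j, (z j - deriv a (η j)) • x j‖ ^ 2
        ∂Measure.pi (fun j => responseLaw a c ν φ (η j)) =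
      ∑ j, φ * iteratedDeriv 2 a (η j) * ‖x j‖ ^ 2 := by
  have hprob := fun j => h.isProbabilityMeasure (η j)
  borelize E
  have hind : iIndepFun (fun j (z : ι → ℝ) => (z j - deriv a (η j)) • x j)
      (Measure.pi fun j => responseLaw a c ν φ (η j)) :=
    iIndepFun_pi (X := fun j y => (y - deriv a (η j)) • x j) fun j => by fun_prop
  rw [integral_norm_sq_sum_of_pairwise_indepFun (fun j _ => h.memLp_residual_smul η x j)
    fun i _ j _ hij => hind.indepFun hij]
  · refine Finset.sum_congr rfl fun j _ => ?_
    simp only [norm_smul, mul_pow, Real.norm_eq_abs, sq_abs]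
    rw [integral_mul_const, integral_comp_eval (X := fun _ => ℝ)
      (μ := fun j => responseLaw a c ν φ (η j)) (f := fun y => (y - deriv a (η j)) ^ 2)
      (by fun_prop), h.integral_sub_mean_sq ha]
  · intro j _
    rw [integral_smul_const, integral_comp_eval (X := fun _ => ℝ)
      (μ := fun j => responseLaw a c ν φ (η j)) (f := fun y => y - deriv a (η j)) (by fun_prop),
      h.integral_sub_mean (ha.differentiable (by norm_num)), zero_smul]

end IsDispersionFamily

end ExponentialFamily

section ProductMeasures

variable {α ι : Type*} [MeasurableSpace α] {β : ι → Type*}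
  [∀ j, MeasurableSpace (β j)]

lemma measure_prod_pi_ext [Finite ι] {ρ ρ' : Measure (α × ∀ j, β j)} [IsFiniteMeasure ρ]
    (h : ∀ B : Set α, MeasurableSet B → ∀ A : (j : ι) → Set (β j), (∀ j, MeasurableSet (A j)) →
      ρ (B ×ˢ Set.univ.pi A) = ρ' (B ×ˢ Set.univ.pi A)) : ρ = ρ' := by
  refine ext_of_generate_finite
    (Set.image2 (· ×ˢ ·) {s : Set α | MeasurableSet s}
      (Set.univ.pi '' Set.univ.pi fun j => {s : Set (β j) | MeasurableSet s}))
    (generateFrom_eq_prod MeasurableSpace.generateFrom_measurableSet generateFrom_pi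
      isCountablySpanning_measurableSet
      (IsCountablySpanning.pi fun _ => isCountablySpanning_measurableSet)).symm
    (MeasurableSpace.isPiSystem_measurableSet.prod isPiSystem_pi) ?_ ?_
  · rintro _ ⟨B, hB, _, ⟨A, hA, rfl⟩, rfl⟩
    exact h B hB A fun j => hA j (Set.mem_univ j)
  · simpa using h Set.univ MeasurableSet.univ (fun _ => Set.univ) fun _ => MeasurableSet.univ

lemma measurable_measure_pi [Fintype ι] {κ : (j : ι) → α → Measure (β j)}
    [∀ j u, IsProbabilityMeasure (κ j u)] (hκ : ∀ j, Measurable (κ j)) :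
    Measurable fun u => Measure.pi fun j => κ j u := by
  refine Measurable.measure_of_isPiSystem_of_isProbabilityMeasure generateFrom_pi.symm
    isPiSystem_pi ?_
  rintro _ ⟨A, hA, rfl⟩
  simp only [Measure.pi_pi]
  exact Finset.measurable_prod _ fun j _ => Measure.measurable_measure.1 (hκ j) _ (hA j trivial)

end ProductMeasures

section RandomEffects

variable {p : ℕ} {Ω : Type*} [MeasurableSpace Ω] {μ : Measure Ω} {S : GLMMSeq p Ω}

lemma memLp_id_multivariateGaussian (b : Vec p) (G : Matrix (Fin p) (Fin p) ℝ) :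
    MemLp id 2 (multivariateGaussian b G) :=
  IsGaussian.memLp_id _ 2 (by norm_num)

lemma integral_norm_sq_multivariateGaussian {G : Matrix (Fin p) (Fin p) ℝ} (hG : G.PosSemidef) :
    ∫ u : Vec p, ‖u‖ ^ 2 ∂multivariateGaussian 0 G = G.trace := by
  have hL : ∀ l, MemLp (fun u : Vec p => u l) 2 (multivariateGaussian 0 G) := fun l =>
    (EuclideanSpace.proj (𝕜 := ℝ) l).comp_memLp' (memLp_id_multivariateGaussian 0 G)
  have h0 : ∀ l, ∫ u : Vec p, u l ∂multivariateGaussian 0 G = 0 := fun l => by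
    simpa using (EuclideanSpace.proj (𝕜 := ℝ) l).integral_comp_comm
      ((memLp_id_multivariateGaussian 0 G).integrable (by norm_num))
  simp only [EuclideanSpace.norm_sq_eq, Real.norm_eq_abs, sq_abs]
  rw [integral_finsetSum _ fun l _ => (hL l).integrable_sq]
  refine Finset.sum_congr rfl fun l _ => ?_
  rw [← variance_of_integral_eq_zero (hL l).aemeasurable (h0 l),
    variance_eval_multivariateGaussian hG, Matrix.diag_apply]

namespace IsGLMM

lemma memLp_b (h : IsGLMM S μ) (i : ℕ) : MemLp (S.b i) 2 μ := by
  have hL := memLp_id_multivariateGaussian 0 S.G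
  rw [← h.law_b i] at hL
  exact (memLp_map_measure_iff hL.1 (h.measurable_b i).aemeasurable).1 hL

lemma integral_b (h : IsGLMM S μ) (i : ℕ) : ∫ ω, S.b i ω ∂μ = 0 := by
  rw [← integral_map (f := fun u : Vec p => u) (h.measurable_b i).aemeasurable (by fun_prop),
    h.law_b, integral_id_multivariateGaussian]

lemma integral_norm_sq_b (h : IsGLMM S μ) (i : ℕ) : ∫ ω, ‖S.b i ω‖ ^ 2 ∂μ = S.G.trace := by
  rw [← integral_norm_sq_multivariateGaussian h.cov_posSemidef, ← h.law_b i,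
    integral_map (h.measurable_b i).aemeasurable (by fun_prop)]

lemma eLpNorm_b_le (h : IsGLMM S μ) (i : ℕ) : eLpNorm (S.b i) 2 μ ≤ ENNReal.ofReal √S.G.trace :=
  eLpNorm_two_le_of_lintegral_le <| by
    rw [lintegral_enorm_sq_eq_ofReal (h.memLp_b i), h.integral_norm_sq_b]

lemma eLpNorm_sum_b_le [IsProbabilityMeasure μ] (h : IsGLMM S μ) (k : ℕ) :
    eLpNorm (fun ω => ∑ i : Fin (S.m k), S.b i ω) 2 μ ≤ ENNReal.ofReal √(S.m k * S.G.trace) := by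
  have hind : Pairwise fun i j : Fin (S.m k) => S.b i ⟂ᵢ[μ] S.b j := fun i j hij =>
    ((h.indep_clusters k).indepFun hij).comp measurable_fst measurable_fst
  have hL : MemLp (fun ω => ∑ i : Fin (S.m k), S.b i ω) 2 μ :=
    memLp_finsetSum _ fun i _ => h.memLp_b i
  refine eLpNorm_two_le_of_lintegral_le ?_
  rw [lintegral_enorm_sq_eq_ofReal hL,
    integral_norm_sq_sum_of_pairwise_indepFun (Y := fun i : Fin (S.m k) => S.b i)
      (fun i _ => h.memLp_b i) (hind.set_pairwise _)
      fun i _ => h.integral_b i]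
  simp [h.integral_norm_sq_b]

end IsGLMM

end RandomEffects

section Score

variable {p : ℕ} {Ω : Type*} [MeasurableSpace Ω] {μ : Measure Ω} {S : GLMMSeq p Ω}

lemma measurable_linPred (x β : Vec p) : Measurable (linPred x β) := by
  unfold linPred
  fun_prop

/-- The conditional law of the responses of cluster `i` given that its random effect is `u`. -/
def clusterLaw {Ω : Type*} (S : GLMMSeq p Ω) (k i : ℕ) (u : Vec p) :
    Measure (Fin (S.n k i) → ℝ) :=
  Measure.pi fun j => responseLaw S.a S.c S.ν S.φ (linPred (S.x k i j) S.β u)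

/-- The score vector `X_iᵀ (y_i - μ_i)` of cluster `i` at the true parameters, without the
factor `φhat⁻¹`. -/
def score {Ω : Type*} (S : GLMMSeq p Ω) (k i : ℕ) (ω : Ω) : Vec p :=
  ∑ j : Fin (S.n k i), S.resid k i ω j • S.x k i j

namespace IsGLMM

lemma isDispersionFamily (h : IsGLMM S μ) : IsDispersionFamily S.a S.c S.ν S.φ :=
  ⟨h.dispersion_pos, h.measurable_c, h.isDensity⟩

lemma isProbabilityMeasure_clusterLaw (h : IsGLMM S μ) (k i : ℕ) (u : Vec p) :
    IsProbabilityMeasure (clusterLaw S k i u) := by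
  have := h.isDispersionFamily.isProbabilityMeasure
  unfold clusterLaw
  infer_instance

lemma measurable_clusterLaw (h : IsGLMM S μ) (ha : Measurable S.a) (k i : ℕ) :
    Measurable (clusterLaw S k i) := by
  have := h.isDispersionFamily.isProbabilityMeasure
  refine measurable_measure_pi fun j => Measure.measurable_of_measurable_coe _ fun A hA => ?_
  exact (h.isDispersionFamily.measurable_responseLaw ha hA).comp (measurable_linPred _ _)

/-- The conditional law of the responses of cluster `i` as a kernel in the random effect. -/
def clusterKernel (h : IsGLMM S μ) (ha : Measurable S.a) (k i : ℕ) :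
    Kernel (Vec p) (Fin (S.n k i) → ℝ) :=
  ⟨clusterLaw S k i, h.measurable_clusterLaw ha k i⟩

lemma measurable_cluster (h : IsGLMM S μ) (k i : ℕ) :
    Measurable fun ω => (S.b i ω, fun j : Fin (S.n k i) => S.y k i j ω) :=
  (h.measurable_b i).prodMk (measurable_pi_lambda _ fun j => h.measurable_y k i j)

lemma map_cluster_eq_compProd [IsProbabilityMeasure μ] (h : IsGLMM S μ) (ha : Measurable S.a)
    {k i : ℕ} (hi : i < S.m k) :
    μ.map (fun ω => (S.b i ω, fun j : Fin (S.n k i) => S.y k i j ω)) =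
      multivariateGaussian 0 S.G ⊗ₘ h.clusterKernel ha k i := by
  have hprob := h.isDispersionFamily.isProbabilityMeasure
  have : IsMarkovKernel (h.clusterKernel ha k i) := ⟨h.isProbabilityMeasure_clusterLaw k i⟩
  refine measure_prod_pi_ext fun B hB A hA => ?_
  rw [Measure.map_apply (h.measurable_cluster k i) (hB.prod (MeasurableSet.univ_pi hA)),
    Measure.compProd_apply_prod hB (MeasurableSet.univ_pi hA)]
  calc μ ((fun ω => (S.b i ω, fun j : Fin (S.n k i) => S.y k i j ω)) ⁻¹' (B ×ˢ Set.univ.pi A))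
      = μ {ω | S.b i ω ∈ B ∧ ∀ j : Fin (S.n k i), S.y k i j ω ∈ A j} := by
        congr 1
        ext
        simp
    _ = ∫⁻ u in B, ∏ j : Fin (S.n k i),
          responseLaw S.a S.c S.ν S.φ (linPred (S.x k i j) S.β u) (A j)
          ∂multivariateGaussian 0 S.G := h.cond_law k i hi B hB A hA
    _ = ∫⁻ u in B, clusterLaw S k i u (Set.univ.pi A) ∂multivariateGaussian 0 S.G := by
        simp only [clusterLaw, Measure.pi_pi]

lemma lintegral_cluster [IsProbabilityMeasure μ] (h : IsGLMM S μ) (ha : Measurable S.a) {k i : ℕ}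
    (hi : i < S.m k) {g : Vec p × (Fin (S.n k i) → ℝ) → ℝ≥0∞} (hg : Measurable g) :
    ∫⁻ ω, g (S.b i ω, fun j => S.y k i j ω) ∂μ =
      ∫⁻ u, ∫⁻ z, g (u, z) ∂clusterLaw S k i u ∂multivariateGaussian 0 S.G := by
  have : IsMarkovKernel (h.clusterKernel ha k i) := ⟨h.isProbabilityMeasure_clusterLaw k i⟩
  rw [← lintegral_map hg (h.measurable_cluster k i), h.map_cluster_eq_compProd ha hi,
    Measure.lintegral_compProd hg]
  rfl

lemma measurable_score (h : IsGLMM S μ) (k i : ℕ) :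
    Measurable (score S k i) := by
  have hb := h.measurable_b i
  have hy := h.measurable_y k i
  unfold score GLMMSeq.resid GLMMSeq.eta linPred
  fun_prop

lemma lintegral_enorm_sq_residual_le (h : IsGLMM S μ) (ha : ContDiff ℝ 2 S.a) {B : ℝ}
    (hB : ∀ η, iteratedDeriv 2 S.a η ≤ B) {k i : ℕ} {C : ℝ} (hC : ∀ j < S.n k i, ‖S.x k i j‖ ≤ C)
    (u : Vec p) :
    ∫⁻ z, ‖∑ j : Fin (S.n k i), (z j - deriv S.a (linPred (S.x k i j) S.β u)) • S.x k i j‖ₑ ^ 2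
        ∂clusterLaw S k i u ≤
      ENNReal.ofReal (S.n k i * (S.φ * B * C ^ 2)) := by
  have hfam := h.isDispersionFamily
  set η : Fin (S.n k i) → ℝ := fun j => linPred (S.x k i j) S.β u
  have hL : MemLp (fun z : Fin (S.n k i) → ℝ =>
      ∑ j : Fin (S.n k i), (z j - deriv S.a (η j)) • S.x k i j) 2 (clusterLaw S k i u) :=
    memLp_finsetSum _ fun j _ =>
      hfam.memLp_residual_smul η (fun j : Fin (S.n k i) => S.x k i j) j
  have hvar : ∀ η, 0 ≤ S.φ * iteratedDeriv 2 S.a η := fun η => by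
    rw [← hfam.integral_sub_mean_sq ha]
    exact integral_nonneg fun _ => sq_nonneg _
  have hle : ∀ η, S.φ * iteratedDeriv 2 S.a η ≤ S.φ * B := fun η =>
    mul_le_mul_of_nonneg_left (hB η) hfam.dispersion_pos.le
  rw [lintegral_enorm_sq_eq_ofReal hL]
  refine ENNReal.ofReal_le_ofReal ?_
  calc ∫ z, ‖∑ j : Fin (S.n k i), (z j - deriv S.a (η j)) • S.x k i j‖ ^ 2 ∂clusterLaw S k i u
      = ∑ j : Fin (S.n k i), S.φ * iteratedDeriv 2 S.a (η j) * ‖S.x k i j‖ ^ 2 :=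
        hfam.integral_norm_sq_sum_residual_smul ha η fun j => S.x k i j
    _ ≤ ∑ _j : Fin (S.n k i), S.φ * B * C ^ 2 := by
        refine Finset.sum_le_sum fun j _ => mul_le_mul (hle _) ?_ (sq_nonneg _)
          ((hvar 0).trans (hle 0))
        exact pow_le_pow_left₀ (norm_nonneg _) (hC j j.2) 2
    _ = S.n k i * (S.φ * B * C ^ 2) := by simp

lemma eLpNorm_score_le [IsProbabilityMeasure μ] (h : IsGLMM S μ) (ha : ContDiff ℝ 2 S.a) {B : ℝ}
    (hB : ∀ η, iteratedDeriv 2 S.a η ≤ B) {k i : ℕ} (hi : i < S.m k) {C : ℝ}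
    (hC : ∀ j < S.n k i, ‖S.x k i j‖ ≤ C) :
    eLpNorm (score S k i) 2 μ ≤ ENNReal.ofReal √(S.n k i * (S.φ * B * C ^ 2)) := by
  have : Measurable (deriv S.a) := (ha.continuous_deriv (by norm_num)).measurable
  have hg : Measurable fun uz : Vec p × (Fin (S.n k i) → ℝ) =>
      ‖∑ j : Fin (S.n k i),
        (uz.2 j - deriv S.a (linPred (S.x k i j) S.β uz.1)) • S.x k i j‖ₑ ^ 2 := by
    unfold linPred
    fun_prop
  refine eLpNorm_two_le_of_lintegral_le ?_
  calc ∫⁻ ω, ‖score S k i ω‖ₑ ^ 2 ∂μ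
      = ∫⁻ u, ∫⁻ z, ‖∑ j : Fin (S.n k i),
          (z j - deriv S.a (linPred (S.x k i j) S.β u)) • S.x k i j‖ₑ ^ 2
          ∂clusterLaw S k i u ∂multivariateGaussian 0 S.G :=
        h.lintegral_cluster ha.continuous.measurable hi hg
    _ ≤ ∫⁻ _, ENNReal.ofReal (S.n k i * (S.φ * B * C ^ 2)) ∂multivariateGaussian 0 S.G :=
        lintegral_mono fun u => h.lintegral_enorm_sq_residual_le ha hB hC u
    _ = ENNReal.ofReal (S.n k i * (S.φ * B * C ^ 2)) := by simp

end IsGLMM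

end Score

section QuadraticForms

variable {p : ℕ} {P : Matrix (Fin p) (Fin p) ℝ}

lemma dotProduct_self_le_trace_inv_mul {M : Matrix (Fin p) (Fin p) ℝ} (hM : M.PosSemidef)
    (hu : IsUnit M) (v : Fin p → ℝ) : v ⬝ᵥ v ≤ (M⁻¹).trace * (v ⬝ᵥ (M *ᵥ v)) := by
  have hdet := (Matrix.isUnit_iff_isUnit_det M).1 hu
  obtain ⟨r, u, hsum⟩ := Matrix.posSemidef_iff_eq_sum_vecMulVec.1 hM.inv
  let C : Matrix (Fin r) (Fin p) ℝ := Matrix.of u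
  have hC : M⁻¹ = Cᵀ * C := by
    rw [hsum]
    ext l l'
    simp [C, Matrix.sum_apply, Matrix.mul_apply, Matrix.vecMulVec_apply]
  set z := C *ᵥ (M *ᵥ v) with hz
  have hv : v = Cᵀ *ᵥ z := by
    rw [hz, Matrix.mulVec_mulVec, ← hC, Matrix.mulVec_mulVec, Matrix.nonsing_inv_mul _ hdet,
      Matrix.one_mulVec]
  have hform : v ⬝ᵥ (M *ᵥ v) = z ⬝ᵥ z := by
    calc v ⬝ᵥ (M *ᵥ v) = (Cᵀ *ᵥ z) ⬝ᵥ (M *ᵥ v) := congrArg (· ⬝ᵥ (M *ᵥ v)) hv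
      _ = z ⬝ᵥ z := by rw [Matrix.mulVec_transpose, ← Matrix.dotProduct_mulVec]
  have htrace : (M⁻¹).trace = ∑ l, ∑ r, C r l ^ 2 := by
    rw [hC]
    simp [Matrix.trace, Matrix.mul_apply, sq]
  rw [hform, htrace, hv]
  simp only [dotProduct, Matrix.mulVec, Matrix.transpose_apply, ← sq]
  rw [Finset.sum_mul]
  exact Finset.sum_le_sum fun l _ => Finset.sum_mul_sq_le_sq_mul_sq _ _ _

lemma trace_le_of_spectrum_subset (hP : P.IsHermitian) {c C : ℝ}
    (h : spectrum ℝ P ⊆ Set.Icc c C) : P.trace ≤ p * C := by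
  rw [hP.trace_eq_sum_eigenvalues]
  calc ∑ l, hP.eigenvalues l ≤ ∑ _l : Fin p, C :=
        Finset.sum_le_sum fun l _ => (h (hP.eigenvalues_mem_spectrum_real l)).2
    _ = p * C := by simp

/-- The sum of the absolute values of the entries of a matrix. It bounds the operator norm and is
bounded in probability as soon as every entry is. -/
def entrySum (P : Matrix (Fin p) (Fin p) ℝ) : ℝ := ∑ l, ∑ l', |P l l'|

lemma entrySum_nonneg (P : Matrix (Fin p) (Fin p) ℝ) : 0 ≤ entrySum P :=
  Finset.sum_nonneg fun _ _ => Finset.sum_nonneg fun _ _ => abs_nonneg _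

lemma abs_dotProduct_mulVec_le (P : Matrix (Fin p) (Fin p) ℝ) (u v : Vec p) :
    |u.ofLp ⬝ᵥ (P *ᵥ v.ofLp)| ≤ entrySum P * (‖u‖ * ‖v‖) := by
  have hentry : ∀ (w : Vec p) l, |w l| ≤ ‖w‖ := fun w l => by simpa using PiLp.norm_apply_le w l
  simp only [dotProduct, Matrix.mulVec, entrySum, Finset.sum_mul, Finset.mul_sum]
  refine (Finset.abs_sum_le_sum_abs _ _).trans (Finset.sum_le_sum fun l _ => ?_)
  refine (Finset.abs_sum_le_sum_abs _ _).trans (Finset.sum_le_sum fun l' _ => ?_)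
  rw [abs_mul, abs_mul, mul_left_comm]
  gcongr <;> apply hentry

lemma dotProduct_mulVec_comm (hP : P.IsHermitian) (u v : Fin p → ℝ) :
    u ⬝ᵥ (P *ᵥ v) = v ⬝ᵥ (P *ᵥ u) := by
  have hPt : Pᵀ = P := by simpa using hP.eq
  rw [Matrix.dotProduct_mulVec, dotProduct_comm, ← Matrix.mulVec_transpose, hPt]

lemma hasDerivAt_quadForm_line (hP : P.IsHermitian) (u v : Vec p) :
    HasDerivAt (fun t : ℝ => (u + t • v).ofLp ⬝ᵥ (P *ᵥ (u + t • v).ofLp))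
      (2 * (v.ofLp ⬝ᵥ (P *ᵥ u.ofLp))) 0 := by
  have hexpand : ∀ t : ℝ, (u + t • v).ofLp ⬝ᵥ (P *ᵥ (u + t • v).ofLp) =
      u.ofLp ⬝ᵥ (P *ᵥ u.ofLp) + t * (2 * (v.ofLp ⬝ᵥ (P *ᵥ u.ofLp))) +
        t ^ 2 * (v.ofLp ⬝ᵥ (P *ᵥ v.ofLp)) := by
    intro t
    simp only [WithLp.ofLp_add, WithLp.ofLp_smul, Matrix.mulVec_add, Matrix.mulVec_smul,
      add_dotProduct, dotProduct_add, smul_dotProduct, dotProduct_smul, smul_eq_mul,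
      dotProduct_mulVec_comm hP u.ofLp v.ofLp]
    ring
  simp only [hexpand]
  have hlinear := ((hasDerivAt_id (0 : ℝ)).mul_const
    (2 * (v.ofLp ⬝ᵥ (P *ᵥ u.ofLp)))).const_add (u.ofLp ⬝ᵥ (P *ᵥ u.ofLp))
  have hsquare := (hasDerivAt_pow 2 (0 : ℝ)).mul_const (v.ofLp ⬝ᵥ (P *ᵥ v.ofLp))
  exact (hlinear.fun_add hsquare).congr_deriv (by simp)

end QuadraticForms

section Optimality

variable {p : ℕ} {a : ℝ → ℝ} {c : ℝ → ℝ → ℝ} {φ : ℝ} {G : Matrix (Fin p) (Fin p) ℝ}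

/-- The contribution of one cluster, with `n` measurements, to the PQL objective function. -/
def clusterObjective (a : ℝ → ℝ) (c : ℝ → ℝ → ℝ) (φ : ℝ) (G : Matrix (Fin p) (Fin p) ℝ) (n : ℕ)
    (x : ℕ → Vec p) (y : ℕ → ℝ) (β b : Vec p) : ℝ :=
  ∑ j ∈ Finset.range n, Real.log (density a c φ (linPred (x j) β b) (y j))
    - 1 / 2 * (b.ofLp ⬝ᵥ (G⁻¹ *ᵥ b.ofLp))

lemma hasDerivAt_log_density_line (ha : Differentiable ℝ a) (y : ℝ) (x β b v : Vec p) :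
    HasDerivAt (fun t : ℝ => Real.log (density a c φ (linPred x β (b + t • v)) y))
      (φ⁻¹ * ((y - deriv a (linPred x β b)) * inner ℝ x v)) 0 := by
  have hlin : ∀ t : ℝ, linPred x β (b + t • v) = linPred x β b + inner ℝ x v * t := by
    intro t
    simp only [linPred, inner_add_right, inner_smul_right]
    ring
  simp only [density, Real.log_exp, hlin]
  have hη : HasDerivAt (fun t => linPred x β b + inner ℝ x v * t) (inner ℝ x v) 0 := by
    simpa using ((hasDerivAt_id (0 : ℝ)).const_mul (inner ℝ x v)).const_add (linPred x β b)
  refine ((((hη.const_mul y).fun_sub (hasDerivAt_comp_affine ha (linPred x β b) (inner ℝ x v)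
    0)).const_mul φ⁻¹).add_const (c y φ)).congr_deriv ?_
  simp only [mul_zero, add_zero]
  ring

lemma hasDerivAt_clusterObjective_line (ha : Differentiable ℝ a) (hG : G.IsHermitian) (n : ℕ)
    (x : ℕ → Vec p) (y : ℕ → ℝ) (β b v : Vec p) :
    HasDerivAt (fun t : ℝ => clusterObjective a c φ G n x y β (b + t • v))
      (∑ j ∈ Finset.range n, φ⁻¹ * ((y j - deriv a (linPred (x j) β b)) * inner ℝ (x j) v)
        - v.ofLp ⬝ᵥ (G⁻¹ *ᵥ b.ofLp)) 0 :=
  ((HasDerivAt.fun_sum fun j _ =>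
    hasDerivAt_log_density_line (c := c) (φ := φ) ha (y j) (x j) β b v).fun_sub
      ((hasDerivAt_quadForm_line hG.inv b v).const_mul (1 / 2))).congr_deriv (by ring)

lemma linPred_add_sub (x β b v : Vec p) : linPred x (β + v) (b - v) = linPred x β b := by
  simp [linPred, inner_add_right, inner_sub_right]

variable {m : ℕ} {n : ℕ → ℕ} {x : ℕ → ℕ → Vec p} {y : ℕ → ℕ → ℝ} {β : Vec p} {b : Fin m → Vec p}

lemma objective_eq_sum_clusterObjective (β : Vec p) (b : Fin m → Vec p) :
    objective a c φ G m n x y (β, b) =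
      ∑ i : Fin m, clusterObjective a c φ G (n i) (x i) (y i) β (b i) := by
  simp only [objective, clusterObjective, Finset.sum_sub_distrib, Finset.mul_sum]

lemma sum_update_sub_sum {ι E : Type*} [Fintype ι] [DecidableEq ι] (F : ι → E → ℝ) (b : ι → E)
    (i₀ : ι) (z : E) :
    ∑ i, F i (Function.update b i₀ z i) - ∑ i, F i (b i) = F i₀ z - F i₀ (b i₀) := by
  rw [← Finset.sum_sub_distrib, Finset.sum_eq_single i₀]
  · simp
  · intro i _ hi
    simp [Function.update_of_ne hi]
  · simp

lemma clusterObjective_le_of_isMax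
    (hmax : ∀ θ, objective a c φ G m n x y θ ≤ objective a c φ G m n x y (β, b)) (i : Fin m)
    (w : Vec p) :
    clusterObjective a c φ G (n i) (x i) (y i) β w ≤
      clusterObjective a c φ G (n i) (x i) (y i) β (b i) := by
  have h := hmax (β, Function.update b i w)
  rw [objective_eq_sum_clusterObjective, objective_eq_sum_clusterObjective] at h
  have hupdate := sum_update_sub_sum
    (fun i : Fin m => clusterObjective a c φ G (n i) (x i) (y i) β) b i w
  linarith

lemma score_eq_of_isMax (ha : Differentiable ℝ a) (hG : G.IsHermitian)
    (hmax : ∀ θ, objective a c φ G m n x y θ ≤ objective a c φ G m n x y (β, b)) (i : Fin m)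
    (v : Vec p) :
    ∑ j ∈ Finset.range (n i), φ⁻¹ * ((y i j - deriv a (linPred (x i j) β (b i))) *
      inner ℝ (x i j) v) = v.ofLp ⬝ᵥ (G⁻¹ *ᵥ (b i).ofLp) := by
  have hlocal : IsLocalMax
      (fun t : ℝ => clusterObjective a c φ G (n i) (x i) (y i) β (b i + t • v)) 0 :=
    Eventually.of_forall fun t => by
      simpa only [zero_smul, add_zero] using clusterObjective_le_of_isMax hmax i (b i + t • v)
  exact sub_eq_zero.1 (hlocal.hasDerivAt_eq_zero
    (hasDerivAt_clusterObjective_line ha hG _ _ _ _ _ _))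

lemma sum_quadForm_le_of_isMax
    (hmax : ∀ θ, objective a c φ G m n x y θ ≤ objective a c φ G m n x y (β, b)) (v : Vec p) :
    ∑ i, (b i).ofLp ⬝ᵥ (G⁻¹ *ᵥ (b i).ofLp) ≤ ∑ i, (b i + v).ofLp ⬝ᵥ (G⁻¹ *ᵥ (b i + v).ofLp) := by
  have h := hmax (β + -v, fun i => b i - -v)
  simp only [objective, linPred_add_sub] at h
  simp only [sub_neg_eq_add] at h
  linarith

lemma sum_eq_zero_of_isMax (hG : G.PosDef)
    (hmax : ∀ θ, objective a c φ G m n x y θ ≤ objective a c φ G m n x y (β, b)) :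
    ∑ i, b i = 0 := by
  set v := ∑ i, b i with hv
  have hlocal : IsLocalMin
      (fun t : ℝ => ∑ i, (b i + t • v).ofLp ⬝ᵥ (G⁻¹ *ᵥ (b i + t • v).ofLp)) 0 :=
    Eventually.of_forall fun t => by
      simpa only [zero_smul, add_zero] using sum_quadForm_le_of_isMax hmax (t • v)
  have hderiv := hlocal.hasDerivAt_eq_zero
    (HasDerivAt.fun_sum fun i _ => hasDerivAt_quadForm_line hG.isHermitian.inv (b i) v)
  have hzero : v.ofLp ⬝ᵥ (G⁻¹ *ᵥ v.ofLp) = 0 := by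
    rw [← Finset.mul_sum, ← dotProduct_sum, ← Matrix.mulVec_sum, ← WithLp.ofLp_sum, ← hv] at hderiv
    linarith
  by_contra hne
  have hpos := hG.inv.dotProduct_mulVec_pos (x := v.ofLp) (by simpa using hne)
  simp only [star_trivial] at hpos
  exact hpos.ne' hzero

lemma mul_sq_le_deriv_sub_mul (ha : ContDiff ℝ 2 a) {c₀ : ℝ}
    (h : ∀ η, c₀ ≤ iteratedDeriv 2 a η) (s t : ℝ) :
    c₀ * (s - t) ^ 2 ≤ (deriv a s - deriv a t) * (s - t) := by
  have hdiff : Differentiable ℝ (deriv a) :=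
    (ContDiff.iterate_deriv' 1 1 (by simpa using ha)).differentiable (by norm_num)
  have hmono : Monotone fun u => deriv a u - c₀ * u := by
    have hderiv : ∀ u, HasDerivAt (fun u => deriv a u - c₀ * u) (iteratedDeriv 2 a u - c₀) u :=
      fun u => by
        rw [iteratedDeriv_succ, iteratedDeriv_one]
        simpa using (hdiff u).hasDerivAt.fun_sub ((hasDerivAt_id u).const_mul c₀)
    exact monotone_of_deriv_nonneg (fun u => (hderiv u).differentiableAt) fun u => by
      rw [(hderiv u).deriv]
      exact sub_nonneg.2 (h u)
  rcases le_total s t with hst | hst <;> have := hmono hst <;> nlinarith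

end Optimality

section CombinedError

variable {p : ℕ} {Ω : Type*} {S : GLMMSeq p Ω} {k : ℕ} {ω : Ω}

/-- At the realisation `ω`, the estimators of stage `k` maximise the PQL objective function. -/
def IsPQLMax (S : GLMMSeq p Ω) (k : ℕ) (ω : Ω) : Prop :=
  ∀ θ : Vec p × (Fin (S.m k) → Vec p),
    objective S.a S.c (S.φhat k ω) (S.Ghat k ω) (S.m k) (S.n k) (S.x k)
        (fun i j => S.y k i j ω) θ ≤
      objective S.a S.c (S.φhat k ω) (S.Ghat k ω) (S.m k) (S.n k) (S.x k)
        (fun i j => S.y k i j ω) (S.βhat k ω, S.bhat k ω)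

/-- The Gram form `|X_i v|²` of the design of cluster `i`. -/
def gram (S : GLMMSeq p Ω) (k i : ℕ) (v : Vec p) : ℝ :=
  ∑ j : Fin (S.n k i), inner ℝ (S.x k i j) v ^ 2

lemma gram_nonneg (k i : ℕ) (v : Vec p) : 0 ≤ gram S k i v :=
  Finset.sum_nonneg fun _ _ => sq_nonneg _

/-- The estimation error of `β + b_i`, the quantity that the responses of cluster `i` identify. -/
def combinedError (S : GLMMSeq p Ω) (k : ℕ) (ω : Ω) (i : Fin (S.m k)) : Vec p :=
  (S.βhat k ω + S.bhat k ω i) - (S.β + S.b i ω)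

/-- The size `φhat |Ghat⁻¹|` of the penalty relative to the log-likelihood of one measurement. -/
def penalty (S : GLMMSeq p Ω) (k : ℕ) (ω : Ω) : ℝ := S.φhat k ω * entrySum (S.Ghat k ω)⁻¹

lemma inner_score (k i : ℕ) (ω : Ω) (v : Vec p) :
    inner ℝ (score S k i ω) v = ∑ j : Fin (S.n k i),
      (S.y k i j ω - deriv S.a (S.eta k i j ω)) * inner ℝ (S.x k i j) v := by
  simp only [score, GLMMSeq.resid, sum_inner, real_inner_smul_left]

lemma linPred_sub_eta (j : ℕ) (i : Fin (S.m k)) :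
    linPred (S.x k i j) (S.βhat k ω) (S.bhat k ω i) - S.eta k i j ω =
      inner ℝ (S.x k i j) (combinedError S k ω i) := by
  simp only [combinedError, GLMMSeq.eta, linPred, inner_sub_right, inner_add_right]

lemma gram_combinedError_le_inner_score (ha : ContDiff ℝ 2 S.a) {c₀ : ℝ}
    (hc₀ : ∀ η, c₀ ≤ iteratedDeriv 2 S.a η) (hG : (S.Ghat k ω).IsHermitian)
    (hφ : S.φhat k ω ≠ 0) (hmax : IsPQLMax S k ω) (i : Fin (S.m k)) :
    c₀ * gram S k i (combinedError S k ω i) ≤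
      inner ℝ (score S k i ω) (combinedError S k ω i) - S.φhat k ω *
        ((combinedError S k ω i).ofLp ⬝ᵥ ((S.Ghat k ω)⁻¹ *ᵥ (S.bhat k ω i).ofLp)) := by
  have hscore := score_eq_of_isMax (ha.differentiable two_ne_zero) hG hmax i
    (combinedError S k ω i)
  rw [← Finset.mul_sum, inv_mul_eq_iff_eq_mul₀ hφ, Finset.sum_range] at hscore
  rw [← hscore, inner_score, ← Finset.sum_sub_distrib, gram, Finset.mul_sum]
  refine Finset.sum_le_sum fun j _ => ?_
  have hmono := mul_sq_le_deriv_sub_mul ha hc₀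
    (linPred (S.x k i j) (S.βhat k ω) (S.bhat k ω i)) (S.eta k i j ω)
  rw [linPred_sub_eta] at hmono
  linarith

lemma neg_le_combinedError_dotProduct_bhat (hG : (S.Ghat k ω).PosDef) (i : Fin (S.m k)) :
    -(entrySum (S.Ghat k ω)⁻¹ *
        (‖combinedError S k ω i‖ * (‖S.b i ω‖ + ‖S.βhat k ω - S.β‖))) ≤
      (combinedError S k ω i).ofLp ⬝ᵥ ((S.Ghat k ω)⁻¹ *ᵥ (S.bhat k ω i).ofLp) := by
  set δ := combinedError S k ω i with hδ
  set Δ := S.βhat k ω - S.β with hΔ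
  have hbhat : S.bhat k ω i = S.b i ω + δ - Δ := by
    simp only [hδ, hΔ, combinedError]
    abel
  have hexpand : δ.ofLp ⬝ᵥ ((S.Ghat k ω)⁻¹ *ᵥ (S.bhat k ω i).ofLp) =
      δ.ofLp ⬝ᵥ ((S.Ghat k ω)⁻¹ *ᵥ (S.b i ω).ofLp) + δ.ofLp ⬝ᵥ ((S.Ghat k ω)⁻¹ *ᵥ δ.ofLp) -
        δ.ofLp ⬝ᵥ ((S.Ghat k ω)⁻¹ *ᵥ Δ.ofLp) := by
    simp [hbhat, Matrix.mulVec_sub, Matrix.mulVec_add, dotProduct_sub, dotProduct_add]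
  have hpos : 0 ≤ δ.ofLp ⬝ᵥ ((S.Ghat k ω)⁻¹ *ᵥ δ.ofLp) := by
    simpa using hG.inv.posSemidef.dotProduct_mulVec_nonneg δ.ofLp
  have hb := neg_le_of_abs_le (abs_dotProduct_mulVec_le (S.Ghat k ω)⁻¹ δ (S.b i ω))
  have hβ := le_of_abs_le (abs_dotProduct_mulVec_le (S.Ghat k ω)⁻¹ δ Δ)
  linarith

lemma gram_combinedError_le (ha : ContDiff ℝ 2 S.a) {c₀ : ℝ}
    (hc₀ : ∀ η, c₀ ≤ iteratedDeriv 2 S.a η) (hG : (S.Ghat k ω).PosDef) (hφ : 0 < S.φhat k ω)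
    (hmax : IsPQLMax S k ω) (i : Fin (S.m k)) :
    c₀ * gram S k i (combinedError S k ω i) ≤ ‖combinedError S k ω i‖ *
      (‖score S k i ω‖ + penalty S k ω * (‖S.b i ω‖ + ‖S.βhat k ω - S.β‖)) := by
  have hgram := gram_combinedError_le_inner_score ha hc₀ hG.isHermitian hφ.ne' hmax i
  have hscore := real_inner_le_norm (score S k i ω) (combinedError S k ω i)
  have hpen := mul_le_mul_of_nonneg_left (neg_le_combinedError_dotProduct_bhat hG i) hφ.le
  simp only [penalty]
  linarith

/-- The score of cluster `i` averaged over its measurements. -/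
def meanScore (S : GLMMSeq p Ω) (k i : ℕ) (ω : Ω) : Vec p :=
  (S.n k i : ℝ)⁻¹ • score S k i ω

/-- The penalty per measurement of the smallest cluster, in units of the lower bound `c₀` of `a''`.
It tends to zero in probability. -/
def relPenalty (S : GLMMSeq p Ω) (c₀ : ℝ) (k : ℕ) (ω : Ω) : ℝ :=
  (c₀ * S.nL k)⁻¹ * penalty S k ω

lemma nL_le {i : ℕ} (hi : i < S.m k) : S.nL k ≤ S.n k i :=
  ciInf_le (OrderBot.bddBelow _) (⟨i, hi⟩ : Fin (S.m k))

lemma relPenalty_nonneg {c₀ : ℝ} (hc₀ : 0 ≤ c₀) (hφ : 0 ≤ S.φhat k ω) :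
    0 ≤ relPenalty S c₀ k ω :=
  mul_nonneg (by positivity) (mul_nonneg hφ (entrySum_nonneg _))

lemma norm_combinedError_le (ha : ContDiff ℝ 2 S.a) {c₀ : ℝ} (hc₀pos : 0 < c₀)
    (hc₀ : ∀ η, c₀ ≤ iteratedDeriv 2 S.a η) (hG : (S.Ghat k ω).PosDef) (hφ : 0 < S.φhat k ω)
    (hmax : IsPQLMax S k ω) (hn : 0 < S.nL k) (i : Fin (S.m k)) {l : ℝ} (hl : 0 ≤ l)
    (hgram : S.n k i * ‖combinedError S k ω i‖ ^ 2 ≤ l * gram S k i (combinedError S k ω i)) :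
    ‖combinedError S k ω i‖ ≤ l * (c₀⁻¹ * ‖meanScore S k i ω‖ +
      relPenalty S c₀ k ω * ‖S.b i ω‖ + relPenalty S c₀ k ω * ‖S.βhat k ω - S.β‖) := by
  set δ := combinedError S k ω i
  have hnL : (0 : ℝ) < S.nL k := by exact_mod_cast hn
  have hle : (S.nL k : ℝ) ≤ S.n k i := by exact_mod_cast nL_le i.2
  have hni : (0 : ℝ) < S.n k i := hnL.trans_le hle
  have hpen : 0 ≤ penalty S k ω := mul_nonneg hφ.le (entrySum_nonneg _)
  set R := ‖score S k i ω‖ + penalty S k ω * (‖S.b i ω‖ + ‖S.βhat k ω - S.β‖) with hR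
  have hsq : ‖δ‖ * ‖δ‖ ≤ ‖δ‖ * (l * ((c₀ * S.n k i)⁻¹ * R)) := by
    calc ‖δ‖ * ‖δ‖ = (c₀ * S.n k i)⁻¹ * (c₀ * (S.n k i * ‖δ‖ ^ 2)) := by field_simp
      _ ≤ (c₀ * S.n k i)⁻¹ * (c₀ * (l * gram S k i δ)) := by gcongr
      _ = (c₀ * S.n k i)⁻¹ * (l * (c₀ * gram S k i δ)) := by ring
      _ ≤ (c₀ * S.n k i)⁻¹ * (l * (‖δ‖ * R)) := by
        gcongr _ * (l * ?_)
        exact gram_combinedError_le ha hc₀ hG hφ hmax i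
      _ = _ := by ring
  have hδ : ‖δ‖ ≤ l * ((c₀ * S.n k i)⁻¹ * R) := by
    rcases (norm_nonneg δ).eq_or_lt with hzero | hpos
    · rw [← hzero]
      positivity
    · exact le_of_mul_le_mul_left hsq hpos
  calc ‖δ‖ ≤ l * ((c₀ * S.n k i)⁻¹ * R) := hδ
    _ = l * (c₀⁻¹ * ((S.n k i : ℝ)⁻¹ * ‖score S k i ω‖) +
        (c₀ * S.n k i)⁻¹ * penalty S k ω * (‖S.b i ω‖ + ‖S.βhat k ω - S.β‖)) := by
      rw [hR]
      field_simp
    _ ≤ l * (c₀⁻¹ * ((S.n k i : ℝ)⁻¹ * ‖score S k i ω‖) +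
        (c₀ * S.nL k)⁻¹ * penalty S k ω * (‖S.b i ω‖ + ‖S.βhat k ω - S.β‖)) := by gcongr
    _ = _ := by
      rw [meanScore, norm_smul, norm_inv, RCLike.norm_natCast, relPenalty]
      ring

end CombinedError

section CentredPredictors

variable {E : Type*} [SeminormedAddCommGroup E] [NormedSpace ℝ E] {m : ℕ} {Δ : E}
  {b bhat : Fin m → E} {l u : Fin m → ℝ} {ρ : ℝ}

/- Averaging the errors of `β + b_i` eliminates the centred predictors, so that only the mean of the
true effects and the absorbed multiple of `‖Δ‖` remain. -/
lemma norm_le_of_sum_eq_zero (hm : 0 < m) (hsum : ∑ i, bhat i = 0)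
    (herr : ∀ i, ‖Δ + bhat i - b i‖ ≤ l i * (u i + ρ * ‖Δ‖))
    (hρ : ρ * ((m : ℝ)⁻¹ * ∑ i, l i) ≤ 1 / 2) :
    ‖Δ‖ ≤ 2 * (‖(m : ℝ)⁻¹ • ∑ i, b i‖ + (m : ℝ)⁻¹ * ∑ i, l i * u i) := by
  have hm' : (m : ℝ) ≠ 0 := by exact_mod_cast hm.ne'
  have hΔ : Δ = (m : ℝ)⁻¹ • ∑ i, b i + (m : ℝ)⁻¹ • ∑ i, (Δ + bhat i - b i) := by
    rw [Finset.sum_sub_distrib, Finset.sum_add_distrib, hsum, ← smul_add]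
    simp [← Nat.cast_smul_eq_nsmul ℝ, smul_smul, hm']
  have hmean : ‖(m : ℝ)⁻¹ • ∑ i, (Δ + bhat i - b i)‖ ≤
      (m : ℝ)⁻¹ * ∑ i, l i * u i + ρ * ((m : ℝ)⁻¹ * ∑ i, l i) * ‖Δ‖ := by
    rw [norm_smul, norm_inv, RCLike.norm_natCast]
    calc (m : ℝ)⁻¹ * ‖∑ i, (Δ + bhat i - b i)‖
        ≤ (m : ℝ)⁻¹ * ∑ i, l i * (u i + ρ * ‖Δ‖) := by
          gcongr
          exact norm_sum_le_of_le _ fun i _ => herr i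
      _ = _ := by
          simp only [mul_add, Finset.sum_add_distrib, ← Finset.sum_mul]
          ring
  have habsorb := mul_le_mul_of_nonneg_right hρ (norm_nonneg Δ)
  have htriangle := norm_add_le ((m : ℝ)⁻¹ • ∑ i, b i) ((m : ℝ)⁻¹ • ∑ i, (Δ + bhat i - b i))
  rw [← hΔ] at htriangle
  linarith

lemma norm_sub_le_of_sum_eq_zero (hsum : ∑ i, bhat i = 0)
    (herr : ∀ i, ‖Δ + bhat i - b i‖ ≤ l i * (u i + ρ * ‖Δ‖))
    (hρ : ρ * ((m : ℝ)⁻¹ * ∑ i, l i) ≤ 1 / 2) (i : Fin m) (hρi : ρ * l i ≤ 1 / 2) :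
    ‖bhat i - b i‖ ≤
      l i * u i + 3 * (‖(m : ℝ)⁻¹ • ∑ i, b i‖ + (m : ℝ)⁻¹ * ∑ i, l i * u i) := by
  have hΔ := norm_le_of_sum_eq_zero i.pos hsum herr hρ
  have hi : ‖bhat i - b i‖ ≤ ‖Δ + bhat i - b i‖ + ‖Δ‖ := by
    calc ‖bhat i - b i‖ = ‖(Δ + bhat i - b i) - Δ‖ := by congr 1; abel
      _ ≤ _ := norm_sub_le _ _
  have habsorb := mul_le_mul_of_nonneg_right hρi (norm_nonneg Δ)
  linarith [herr i]

end CentredPredictors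

section InformationMatrix

variable {p : ℕ} {Ω : Type*} {S : GLMMSeq p Ω} {k i : ℕ} {ω : Ω}

lemma X_mulVec_apply (v : Vec p) (j : Fin (S.n k i)) :
    (S.X k i *ᵥ v.ofLp) j = inner ℝ (S.x k i j) v := by
  simp [Matrix.mulVec, dotProduct, GLMMSeq.X, PiLp.inner_apply, mul_comm]

lemma dotProduct_info (k i : ℕ) (ω : Ω) (v : Vec p) :
    v.ofLp ⬝ᵥ (S.info k i ω *ᵥ v.ofLp) = (S.φhat k ω)⁻¹ *
      ∑ j : Fin (S.n k i), iteratedDeriv 2 S.a (S.eta k i j ω) * inner ℝ (S.x k i j) v ^ 2 := by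
  rw [GLMMSeq.info, ← Matrix.mulVec_mulVec, ← Matrix.mulVec_mulVec, Matrix.mulVec_transpose,
    dotProduct_comm, ← Matrix.dotProduct_mulVec, dotProduct_comm, GLMMSeq.W, Matrix.smul_mulVec,
    dotProduct_smul, smul_eq_mul, dotProduct]
  simp only [Matrix.mulVec_diagonal, X_mulVec_apply]
  congr 1
  exact Finset.sum_congr rfl fun j _ => by ring

lemma posSemidef_info (hφ : 0 ≤ S.φhat k ω) (ha : ∀ η, 0 ≤ iteratedDeriv 2 S.a η) :
    (S.info k i ω).PosSemidef := by
  have hW : (S.W k i ω).PosSemidef :=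
    (Matrix.PosSemidef.diagonal fun j => ha _).smul (inv_nonneg.2 hφ)
  simpa [GLMMSeq.info] using hW.conjTranspose_mul_mul_same (S.X k i)

lemma posSemidef_H (hφ : 0 ≤ S.φhat k ω) (hφ' : 0 ≤ S.φ)
    (ha : ∀ η, 0 ≤ iteratedDeriv 2 S.a η) : (S.H k i ω).PosSemidef :=
  ((posSemidef_info hφ ha).smul (by positivity)).inv

lemma norm_sq_le_trace_H_mul_gram {B : ℝ} (ha : ∀ η, 0 ≤ iteratedDeriv 2 S.a η)
    (hB : ∀ η, iteratedDeriv 2 S.a η ≤ B) (hn : 0 < S.n k i) (hφ : 0 < S.φhat k ω)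
    (hφ' : 0 < S.φ) (hu : IsUnit (S.info k i ω)) (v : Vec p) :
    S.n k i * ‖v‖ ^ 2 ≤ B / S.φ * (S.H k i ω).trace * gram S k i v := by
  have hn' : (0 : ℝ) < S.n k i := by exact_mod_cast hn
  have hr : 0 < (S.n k i : ℝ)⁻¹ * S.φhat k ω * S.φ⁻¹ := by positivity
  have hu' : IsUnit (((S.n k i : ℝ)⁻¹ * S.φhat k ω * S.φ⁻¹) • S.info k i ω) := by
    simpa [Units.smul_def] using hu.smul (Units.mk0 _ hr.ne')
  have htrace : v.ofLp ⬝ᵥ v.ofLp ≤ (S.H k i ω).trace * (v.ofLp ⬝ᵥ _) :=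
    dotProduct_self_le_trace_inv_mul ((posSemidef_info hφ.le ha).smul hr.le) hu' v.ofLp
  have hnorm : v.ofLp ⬝ᵥ v.ofLp = ‖v‖ ^ 2 := by
    rw [EuclideanSpace.real_norm_sq_eq, dotProduct]
    simp only [sq]
  rw [hnorm, Matrix.smul_mulVec, dotProduct_smul, dotProduct_info, smul_eq_mul] at htrace
  have hH : 0 ≤ (S.H k i ω).trace := (posSemidef_H hφ.le hφ'.le ha).trace_nonneg
  have hweights : ∑ j : Fin (S.n k i),
      iteratedDeriv 2 S.a (S.eta k i j ω) * inner ℝ (S.x k i j) v ^ 2 ≤ B * gram S k i v := by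
    rw [gram, Finset.mul_sum]
    exact Finset.sum_le_sum fun j _ => mul_le_mul_of_nonneg_right (hB _) (sq_nonneg _)
  calc S.n k i * ‖v‖ ^ 2
      ≤ S.n k i * ((S.H k i ω).trace * ((S.n k i : ℝ)⁻¹ * S.φhat k ω * S.φ⁻¹ *
        ((S.φhat k ω)⁻¹ * (B * gram S k i v)))) := by
        refine mul_le_mul_of_nonneg_left (htrace.trans ?_) hn'.le
        gcongr
    _ = _ := by field_simp

/-- The reciprocal of the smallest eigenvalue of `n_i⁻¹ X_iᵀ X_i`. A vector in the kernel of `X_i`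
contributes `0` by the convention `x / 0 = 0`, so that the definition is meaningful for matrices
`X_i` of full column rank only. -/
def invMinEig (S : GLMMSeq p Ω) (k i : ℕ) : ℝ :=
  ⨆ v : Vec p, S.n k i * ‖v‖ ^ 2 / gram S k i v

lemma invMinEig_nonneg (k i : ℕ) : 0 ≤ invMinEig S k i :=
  Real.iSup_nonneg fun v => div_nonneg (by positivity) (gram_nonneg k i v)

lemma le_invMinEig_mul_gram {T : ℝ} (h : ∀ v, S.n k i * ‖v‖ ^ 2 ≤ T * gram S k i v) (v : Vec p) :
    S.n k i * ‖v‖ ^ 2 ≤ invMinEig S k i * gram S k i v := by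
  rcases (gram_nonneg (S := S) k i v).eq_or_lt with hzero | hpos
  · simpa only [← hzero, mul_zero] using h v
  rw [← div_le_iff₀ hpos]
  refine le_ciSup (f := fun v : Vec p => S.n k i * ‖v‖ ^ 2 / gram S k i v) ⟨max T 0, ?_⟩ v
  rintro _ ⟨w, rfl⟩
  exact div_le_of_le_mul₀ (gram_nonneg k i w) (le_max_right _ _) ((h w).trans
    (mul_le_mul_of_nonneg_right (le_max_left _ _) (gram_nonneg k i w)))

lemma invMinEig_le {T : ℝ} (hT : 0 ≤ T) (h : ∀ v, S.n k i * ‖v‖ ^ 2 ≤ T * gram S k i v) :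
    invMinEig S k i ≤ T :=
  Real.iSup_le (fun v => div_le_of_le_mul₀ (gram_nonneg k i v) hT (h v)) hT

end InformationMatrix

section InProbability

variable {Ω : Type*} [MeasurableSpace Ω] {μ : Measure Ω}

lemma BoundedInProbability.of_forall_le {Z Z₁ Z₂ : ℕ → Ω → ℝ} (h₁ : BoundedInProbability μ Z₁)
    (h₂ : BoundedInProbability μ Z₂)
    (h : ∀ M₁ M₂ : ℝ, ∃ M : ℝ, ∀ k ω, |Z₁ k ω| ≤ M₁ → |Z₂ k ω| ≤ M₂ → |Z k ω| ≤ M) :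
    BoundedInProbability μ Z := by
  intro ε hε
  obtain ⟨M₁, hM₁⟩ := h₁ (ε / 2) (ENNReal.half_pos hε.ne')
  obtain ⟨M₂, hM₂⟩ := h₂ (ε / 2) (ENNReal.half_pos hε.ne')
  obtain ⟨M, hM⟩ := h M₁ M₂
  refine ⟨M, ?_⟩
  filter_upwards [hM₁, hM₂] with k hk₁ hk₂
  calc μ {ω | M < |Z k ω|} ≤ μ ({ω | M₁ < |Z₁ k ω|} ∪ {ω | M₂ < |Z₂ k ω|}) := by
        refine measure_mono fun ω hω => ?_
        by_contra hcon
        simp only [Set.mem_union, Set.mem_ofPred_eq, not_or, not_lt] at hcon hω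
        exact absurd (hM k ω hcon.1 hcon.2) (not_le.2 hω)
    _ ≤ ε / 2 + ε / 2 := (measure_union_le _ _).trans (add_le_add hk₁ hk₂)
    _ = ε := ENNReal.add_halves ε

lemma BoundedInProbability.add {Z₁ Z₂ : ℕ → Ω → ℝ} (h₁ : BoundedInProbability μ Z₁)
    (h₂ : BoundedInProbability μ Z₂) : BoundedInProbability μ fun k ω => Z₁ k ω + Z₂ k ω :=
  .of_forall_le h₁ h₂ fun M₁ M₂ =>
    ⟨M₁ + M₂, fun _ _ hM₁ hM₂ => (abs_add_le _ _).trans (add_le_add hM₁ hM₂)⟩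

lemma BoundedInProbability.mul {Z₁ Z₂ : ℕ → Ω → ℝ} (h₁ : BoundedInProbability μ Z₁)
    (h₂ : BoundedInProbability μ Z₂) : BoundedInProbability μ fun k ω => Z₁ k ω * Z₂ k ω :=
  .of_forall_le h₁ h₂ fun M₁ M₂ => ⟨M₁ * M₂, fun _ _ hM₁ hM₂ => by
    rw [abs_mul]
    exact mul_le_mul hM₁ hM₂ (abs_nonneg _) ((abs_nonneg _).trans hM₁)⟩

lemma boundedInProbability_abs_iff {Z : ℕ → Ω → ℝ} :
    BoundedInProbability μ (fun k ω => |Z k ω|) ↔ BoundedInProbability μ Z := by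
  simp only [BoundedInProbability, abs_abs]

lemma boundedInProbability_const (c : ℝ) : BoundedInProbability μ fun _ _ => c :=
  fun ε _ => ⟨|c|, by simp⟩

lemma BoundedInProbability.sum {ι : Type*} {Z : ι → ℕ → Ω → ℝ} (s : Finset ι)
    (h : ∀ i ∈ s, BoundedInProbability μ (Z i)) :
    BoundedInProbability μ fun k ω => ∑ i ∈ s, Z i k ω := by
  classical
  induction s using Finset.induction_on with
  | empty => simpa using boundedInProbability_const 0
  | insert i s hi ih =>
    simp only [Finset.sum_insert hi]
    exact (h i (by simp)).add (ih fun j hj => h j (by simp [hj]))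

variable {E : Type*} [SeminormedAddCommGroup E]

lemma boundedInProbability_norm_of_eLpNorm_le {f : ℕ → Ω → E}
    (hf : ∀ k, AEStronglyMeasurable (f k) μ) {V : ℝ≥0∞} (hV : V ≠ ∞)
    (h : ∀ᶠ k in atTop, eLpNorm (f k) 2 μ ≤ V) : BoundedInProbability μ fun k ω => ‖f k ω‖ := by
  intro ε hε
  have hlim : Tendsto (fun M : ℝ => (ENNReal.ofReal M)⁻¹ ^ 2 * V ^ 2) atTop (𝓝 0) := by
    have hinv : Tendsto (fun M : ℝ => (ENNReal.ofReal M)⁻¹ ^ 2) atTop (𝓝 0) := by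
      have hinv₁ : Tendsto (fun M : ℝ => (ENNReal.ofReal M)⁻¹) atTop (𝓝 0) := by
        simpa using ENNReal.tendsto_ofReal_atTop.inv
      simpa using ENNReal.Tendsto.pow (n := 2) hinv₁
    simpa using ENNReal.Tendsto.mul_const hinv (.inr (ENNReal.pow_ne_top hV))
  obtain ⟨M, hMε, hMpos⟩ :=
    ((hlim.eventually (gt_mem_nhds hε)).and (eventually_gt_atTop 0)).exists
  refine ⟨M, h.mono fun k hk => ?_⟩
  calc μ {ω | M < |‖f k ω‖|} ≤ μ {ω | ENNReal.ofReal M ≤ ‖f k ω‖ₑ} :=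
        measure_mono fun ω hω => by
          rw [Set.mem_ofPred_eq, abs_norm] at hω
          simpa [← ofReal_norm] using ENNReal.ofReal_le_ofReal hω.le
    _ ≤ (ENNReal.ofReal M)⁻¹ ^ 2 * eLpNorm (f k) 2 μ ^ 2 := by
        simpa using meas_ge_le_mul_pow_eLpNorm_enorm μ two_ne_zero (by simp) (hf k)
          (ENNReal.ofReal_pos.2 hMpos).ne' (by simp)
    _ ≤ (ENNReal.ofReal M)⁻¹ ^ 2 * V ^ 2 := by gcongr
    _ ≤ ε := hMε.le

lemma tendstoInMeasure_norm_of_eLpNorm_le {f : ℕ → Ω → E}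
    (hf : ∀ k, AEStronglyMeasurable (f k) μ) {q : ℕ → ℝ}
    (h : ∀ᶠ k in atTop, eLpNorm (f k) 2 μ ≤ ENNReal.ofReal (q k)) (hq : Tendsto q atTop (𝓝 0)) :
    TendstoInMeasure μ (fun k ω => ‖f k ω‖) atTop fun _ => 0 := by
  have hnorm (k : ℕ) : eLpNorm ((fun ω => ‖f k ω‖) - fun _ => (0 : ℝ)) 2 μ = eLpNorm (f k) 2 μ :=
    eLpNorm_congr_enorm_ae (ae_of_all _ fun ω => by simp)
  refine tendstoInMeasure_of_tendsto_eLpNorm two_ne_zero (fun k => (hf k).norm)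
    aestronglyMeasurable_const ?_
  simp only [hnorm]
  exact tendsto_of_tendsto_of_tendsto_of_le_of_le' tendsto_const_nhds
    (by simpa using ENNReal.tendsto_ofReal hq) (Eventually.of_forall fun _ => zero_le) h

lemma tendstoInMeasure_sub_zero_iff {f : ℕ → Ω → E} {g : Ω → E} :
    TendstoInMeasure μ (fun k ω => f k ω - g ω) atTop (fun _ => 0) ↔
      TendstoInMeasure μ f atTop g := by
  simp only [tendstoInMeasure_iff_norm, sub_zero]

lemma tendstoInMeasure_add {f₁ f₂ : ℕ → Ω → E} {g₁ g₂ : Ω → E}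
    (h₁ : TendstoInMeasure μ f₁ atTop g₁) (h₂ : TendstoInMeasure μ f₂ atTop g₂) :
    TendstoInMeasure μ (fun k ω => f₁ k ω + f₂ k ω) atTop (fun ω => g₁ ω + g₂ ω) := by
  rw [tendstoInMeasure_iff_norm] at h₁ h₂ ⊢
  intro ε hε
  have hlim := (h₁ (ε / 2) (half_pos hε)).add (h₂ (ε / 2) (half_pos hε))
  rw [add_zero] at hlim
  refine tendsto_of_tendsto_of_tendsto_of_le_of_le tendsto_const_nhds hlim (fun _ => zero_le)
    fun k => (measure_mono fun ω hω => ?_).trans (measure_union_le _ _)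
  by_contra hcon
  simp only [Set.mem_union, Set.mem_ofPred_eq, not_or, not_le] at hcon hω
  rw [add_sub_add_comm] at hω
  linarith [norm_add_le (f₁ k ω - g₁ ω) (f₂ k ω - g₂ ω)]

lemma tendstoInMeasure_sum {ι : Type*} (s : Finset ι) {f : ι → ℕ → Ω → E} {g : ι → Ω → E}
    (h : ∀ i ∈ s, TendstoInMeasure μ (f i) atTop (g i)) :
    TendstoInMeasure μ (fun k ω => ∑ i ∈ s, f i k ω) atTop (fun ω => ∑ i ∈ s, g i ω) := by
  classical
  induction s using Finset.induction_on with
  | empty =>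
    rw [tendstoInMeasure_iff_norm]
    intro ε hε
    simp [not_le.2 hε]
  | insert i s hi ih =>
    simp only [Finset.sum_insert hi]
    exact tendstoInMeasure_add (h i (by simp)) (ih fun j hj => h j (by simp [hj]))

lemma tendstoInMeasure_zero_add {f₁ f₂ : ℕ → Ω → E}
    (h₁ : TendstoInMeasure μ f₁ atTop fun _ => 0) (h₂ : TendstoInMeasure μ f₂ atTop fun _ => 0) :
    TendstoInMeasure μ (fun k ω => f₁ k ω + f₂ k ω) atTop fun _ => 0 := by
  simpa using tendstoInMeasure_add h₁ h₂

lemma BoundedInProbability.mul_tendstoInMeasure_zero {Z ρ : ℕ → Ω → ℝ}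
    (hZ : BoundedInProbability μ Z) (hρ : TendstoInMeasure μ ρ atTop fun _ => 0) :
    TendstoInMeasure μ (fun k ω => Z k ω * ρ k ω) atTop fun _ => 0 := by
  rw [tendstoInMeasure_iff_norm] at hρ ⊢
  intro ε hε
  refine ENNReal.tendsto_nhds_zero.2 fun η hη => ?_
  obtain ⟨M, hM⟩ := hZ (η / 2) (ENNReal.half_pos hη.ne')
  have hc : (0 : ℝ) < max M 1 := lt_max_of_lt_right one_pos
  filter_upwards [hM, ENNReal.tendsto_nhds_zero.1 (hρ (ε / max M 1) (by positivity)) (η / 2)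
    (ENNReal.half_pos hη.ne')] with k hkZ hkρ
  calc μ {ω | ε ≤ ‖Z k ω * ρ k ω - 0‖}
      ≤ μ ({ω | M < |Z k ω|} ∪ {ω | ε / max M 1 ≤ ‖ρ k ω - 0‖}) := by
        refine measure_mono fun ω hω => ?_
        by_contra hcon
        simp only [Set.mem_union, Set.mem_ofPred_eq, not_or, not_lt, not_le, sub_zero, norm_mul,
          Real.norm_eq_abs, lt_div_iff₀ hc] at hcon hω
        have := mul_le_mul_of_nonneg_right (hcon.1.trans (le_max_left M 1)) (abs_nonneg (ρ k ω))
        linarith [hcon.2]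
    _ ≤ η / 2 + η / 2 := (measure_union_le _ _).trans (add_le_add hkZ hkρ)
    _ = η := ENNReal.add_halves η

lemma tendstoInMeasure_zero_const_mul (c : ℝ) {ρ : ℕ → Ω → ℝ}
    (hρ : TendstoInMeasure μ ρ atTop fun _ => 0) :
    TendstoInMeasure μ (fun k ω => c * ρ k ω) atTop fun _ => 0 :=
  (boundedInProbability_const c).mul_tendstoInMeasure_zero hρ

lemma BoundedInProbability.tendsto_mul [IsFiniteMeasure μ] {Z : ℕ → Ω → ℝ}
    (hZ : BoundedInProbability μ Z) {t : ℕ → ℝ} (ht : Tendsto t atTop (𝓝 0)) :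
    TendstoInMeasure μ (fun k ω => t k * Z k ω) atTop fun _ => 0 := by
  simp only [mul_comm (t _)]
  exact hZ.mul_tendstoInMeasure_zero (tendstoInMeasure_of_tendsto_ae
    (fun _ => aestronglyMeasurable_const) (ae_of_all _ fun _ => ht))

lemma tendstoInMeasure_zero_of_norm_le_of_lt {Z : ℕ → Ω → E} {ρ R : ℕ → Ω → ℝ} {c : ℝ}
    (hc : 0 < c) (hρ : TendstoInMeasure μ ρ atTop fun _ => 0)
    (hR : TendstoInMeasure μ R atTop fun _ => 0)
    (h : ∀ᶠ k in atTop, ∀ᵐ ω ∂μ, ρ k ω < c → ‖Z k ω‖ ≤ R k ω) :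
    TendstoInMeasure μ Z atTop fun _ => 0 := by
  rw [tendstoInMeasure_iff_norm] at hρ hR ⊢
  intro ε hε
  have hlim := (hρ c hc).add (hR ε hε)
  rw [add_zero] at hlim
  refine tendsto_of_tendsto_of_tendsto_of_le_of_le' tendsto_const_nhds hlim
    (Eventually.of_forall fun _ => zero_le) (h.mono fun k hk => ?_)
  refine (measure_mono_ae ?_).trans (measure_union_le _ _)
  filter_upwards [hk] with ω hω hωε
  by_contra hcon
  have hsmall : ¬(c ≤ ‖ρ k ω - 0‖ ∨ ε ≤ ‖R k ω - 0‖) := hcon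
  have hlarge : ε ≤ ‖Z k ω - 0‖ := hωε
  simp only [sub_zero, Real.norm_eq_abs, not_or, not_le] at hsmall hlarge
  linarith [hω ((le_abs_self _).trans_lt hsmall.1), le_abs_self (R k ω)]

lemma tendstoInMeasure_zero_of_norm_le {Z : ℕ → Ω → E} {R : ℕ → Ω → ℝ}
    (hR : TendstoInMeasure μ R atTop fun _ => 0) (h : ∀ᶠ k in atTop, ∀ ω, ‖Z k ω‖ ≤ R k ω) :
    TendstoInMeasure μ Z atTop fun _ => 0 :=
  tendstoInMeasure_zero_of_norm_le_of_lt (ρ := fun _ _ => 0) one_pos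
    (by simpa using tendstoInMeasure_zero_const_mul 0 hR) hR
    (h.mono fun _ hk => ae_of_all _ fun ω _ => hk ω)

lemma eventually_le_of_tendstoInMeasure [IsProbabilityMeasure μ] {f : ℕ → Ω → ℝ} {g : Ω → ℝ}
    (h : TendstoInMeasure μ f atTop g) {B : ℝ} (hB : ∀ᵐ ω ∂μ, g ω ≤ B) {t : ℕ → ℝ}
    (ht : ∀ᶠ k in atTop, ∀ᵐ ω ∂μ, t k ≤ f k ω) : ∀ᶠ k in atTop, t k ≤ B + 1 := by
  have hone := tendstoInMeasure_iff_norm.1 h 1 one_pos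
  filter_upwards [hone.eventually (gt_mem_nhds one_pos), ht] with k hk htk
  by_contra hcon
  have hfull : {ω | 1 ≤ ‖f k ω - g ω‖} =ᵐ[μ] Set.univ := by
    refine eventuallyEq_univ.2 ?_
    filter_upwards [hB, htk] with ω hg hf
    exact (by linarith : 1 ≤ f k ω - g ω).trans (le_abs_self _)
  rw [measure_congr hfull, measure_univ] at hk
  exact lt_irrefl _ hk

end InProbability

section Design

variable {p : ℕ} {Ω : Type*} {S : GLMMSeq p Ω}

lemma nL_le_nBar {k : ℕ} (hk : 0 < S.m k) : (S.nL k : ℝ) ≤ S.nBar k := by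
  rw [GLMMSeq.nBar, le_div_iff₀ (by exact_mod_cast hk)]
  calc (S.nL k : ℝ) * S.m k = ∑ _i : Fin (S.m k), (S.nL k : ℝ) := by simp [mul_comm]
    _ ≤ ∑ i : Fin (S.m k), (S.n k i : ℝ) :=
        Finset.sum_le_sum fun i _ => by exact_mod_cast nL_le i.2

lemma one_le_mul_nBar_mul_inv {C : ℝ} (hC : 0 ≤ C) {k i : ℕ} (hi : i < S.m k) (hn : 0 < S.n k i)
    (hbal : (S.n k i : ℝ) ≤ C * S.nL k) : 1 ≤ C * (S.nBar k * (S.n k i : ℝ)⁻¹) := by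
  rw [← mul_assoc, ← div_eq_mul_inv, one_le_div (by exact_mod_cast hn)]
  exact hbal.trans (mul_le_mul_of_nonneg_left (nL_le_nBar (i.zero_le.trans_lt hi)) hC)

/-- The regularity of a sequence of designs on which consistency rests. The factor `L k i` converts
the Gram form of cluster `i` into a bound for the squared norm per observation, and all that is
asked of these factors is to be bounded for each cluster and on average over the clusters. -/
structure DesignBound (S : GLMMSeq p Ω) (L : ℕ → ℕ → ℝ) : Prop where
  nonneg : ∀ k i, 0 ≤ L k i
  coercive : ∀ᶠ k in atTop, ∀ i < S.m k, ∀ v, S.n k i * ‖v‖ ^ 2 ≤ L k i * gram S k i v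
  bounded : ∀ i, ∃ C : ℝ, ∀ᶠ k in atTop, L k i ≤ C
  mean_bounded : ∃ K : ℝ, ∀ᶠ k in atTop, (S.m k : ℝ)⁻¹ * ∑ i : Fin (S.m k), L k i ≤ K
  norm_x_bounded : ∃ C : ℝ, ∀ k, ∀ i < S.m k, ∀ j < S.n k i, ‖S.x k i j‖ ≤ C

lemma mean_le_of_le_trace_H {k : ℕ} {ω : Ω} {ℓ : ℕ → ℝ} {c C : ℝ} (hC : 0 ≤ C)
    (hn : 0 < S.nL k) (hbal : ∀ i < S.m k, (S.n k i : ℝ) ≤ C * S.nL k)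
    (hnonneg : ∀ i, 0 ≤ ℓ i) (hℓ : ∀ i : Fin (S.m k), ℓ i ≤ c * (S.H k i ω).trace) :
    (S.m k : ℝ)⁻¹ * ∑ i : Fin (S.m k), ℓ i ≤ c * C * ((S.m k : ℝ)⁻¹ *
      ∑ i : Fin (S.m k), S.nBar k * (S.n k i : ℝ)⁻¹ * (S.H k i ω).trace) := by
  rw [mul_left_comm, Finset.mul_sum (a := c * C)]
  gcongr with i
  have htrace : 0 ≤ c * (S.H k i ω).trace := (hnonneg i).trans (hℓ i)
  have hratio := one_le_mul_nBar_mul_inv hC i.2 (hn.trans_le (nL_le i.2)) (hbal i i.2)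
  calc ℓ i ≤ c * (S.H k i ω).trace := hℓ i
    _ ≤ C * (S.nBar k * (S.n k i : ℝ)⁻¹) * (c * (S.H k i ω).trace) :=
        le_mul_of_one_le_left htrace hratio
    _ = c * C * (S.nBar k * (S.n k i : ℝ)⁻¹ * (S.H k i ω).trace) := by ring

variable [MeasurableSpace Ω] {μ : Measure Ω}

lemma CondC2.exists_norm_x_le (h : CondC2 S μ) :
    ∃ C : ℝ, ∀ k, ∀ i < S.m k, ∀ j < S.n k i, ‖S.x k i j‖ ≤ C := by
  obtain ⟨C, hC⟩ := h.bounded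
  refine ⟨√(p * C ^ 2), fun k i hi j hj => Real.le_sqrt_of_sq_le ?_⟩
  calc ‖S.x k i j‖ ^ 2 = ∑ l, S.x k i j l ^ 2 := EuclideanSpace.real_norm_sq_eq _
    _ ≤ ∑ _l : Fin p, C ^ 2 := Finset.sum_le_sum fun l _ =>
        sq_le_sq.2 ((hC k i hi j hj l).le.trans (le_abs_self C))
    _ = p * C ^ 2 := by simp

variable [IsProbabilityMeasure μ]

lemma CondC2.exists_eventually_le (h : CondC2 S μ) (hm : Tendsto S.m atTop atTop)
    {L : ℕ → ℕ → ℝ} {c : ℝ} (hc : 0 < c)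
    (hL : ∀ᶠ k in atTop, ∀ i < S.m k, ∀ᵐ ω ∂μ, L k i ≤ c * (S.H k i ω).trace) (i : ℕ) :
    ∃ C : ℝ, ∀ᶠ k in atTop, L k i ≤ C := by
  obtain ⟨Kc, K, c₁, -, hlim, -, hKc, -⟩ := h.limits
  have htrace : TendstoInMeasure μ (fun k ω => (S.H k i ω).trace) atTop fun ω => (Kc i ω).trace :=
    tendstoInMeasure_sum Finset.univ fun l _ => hlim i l l
  have htrace_le : ∀ᵐ ω ∂μ, (Kc i ω).trace ≤ p * c₁⁻¹ := (hKc i).mono fun ω hω =>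
    trace_le_of_spectrum_subset hω.1.isHermitian hω.2
  refine ⟨c * (p * c₁⁻¹ + 1), ?_⟩
  simp only [← inv_mul_le_iff₀ hc]
  refine eventually_le_of_tendstoInMeasure htrace htrace_le ?_
  filter_upwards [hL, hm.eventually_gt_atTop i] with k hk hik
  simpa only [inv_mul_le_iff₀ hc] using hk i hik

lemma CondC2.exists_eventually_mean_le (h : CondC2 S μ) (hgrowth : Growth S)
    {L : ℕ → ℕ → ℝ} (hnonneg : ∀ k i, 0 ≤ L k i) {c : ℝ} (hc : 0 < c)
    (hL : ∀ᶠ k in atTop, ∀ i < S.m k, ∀ᵐ ω ∂μ, L k i ≤ c * (S.H k i ω).trace) :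
    ∃ C : ℝ, ∀ᶠ k in atTop, (S.m k : ℝ)⁻¹ * ∑ i : Fin (S.m k), L k i ≤ C := by
  obtain ⟨Kc, K, c₁, -, -, hlim, -, hK⟩ := h.limits
  obtain ⟨C, hC⟩ := hgrowth.balanced
  have htrace : TendstoInMeasure μ (fun k ω => (S.m k : ℝ)⁻¹ *
      ∑ i : Fin (S.m k), S.nBar k * (S.n k i : ℝ)⁻¹ * (S.H k i ω).trace) atTop
      fun ω => (K ω).trace := by
    refine (tendstoInMeasure_sum Finset.univ fun l _ => hlim l l).congr_left fun k => ?_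
    refine ae_of_all _ fun ω => ?_
    simp only [← Finset.mul_sum, Finset.sum_comm (s := (Finset.univ : Finset (Fin p)))]
    rfl
  have htrace_le : ∀ᵐ ω ∂μ, (K ω).trace ≤ p * c₁⁻¹ := hK.mono fun ω hω =>
    trace_le_of_spectrum_subset hω.1.isHermitian hω.2
  have hcC : 0 < c * max C 1 := mul_pos hc (lt_max_of_lt_right one_pos)
  refine ⟨c * max C 1 * (p * c₁⁻¹ + 1), ?_⟩
  simp only [← inv_mul_le_iff₀ hcC]
  refine eventually_le_of_tendstoInMeasure htrace htrace_le ?_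
  filter_upwards [hL, hC, hgrowth.nL_tendsto.eventually_gt_atTop 0] with k hLk hCk hn
  filter_upwards [ae_all_iff.2 fun i : Fin (S.m k) => hLk i i.2] with ω hω
  rw [inv_mul_le_iff₀ hcC]
  refine mean_le_of_le_trace_H (by positivity) hn (fun i hi => ?_) (hnonneg k) hω
  exact (hCk i hi).trans (by gcongr; exact le_max_left C 1)

lemma eventually_invMinEig (hmodel : IsGLMM S μ) (hn : Tendsto S.nL atTop atTop)
    (hC2 : CondC2 S μ) (hC4 : CondC4 S μ) {B : ℝ} (ha : ∀ η, 0 ≤ iteratedDeriv 2 S.a η)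
    (hB : ∀ η, iteratedDeriv 2 S.a η ≤ B) :
    ∀ᶠ k in atTop, ∀ i < S.m k,
      (∀ v, S.n k i * ‖v‖ ^ 2 ≤ invMinEig S k i * gram S k i v) ∧
      ∀ᵐ ω ∂μ, invMinEig S k i ≤ B / S.φ * (S.H k i ω).trace := by
  have hφ := hmodel.dispersion_pos
  have hB₀ : 0 ≤ B := (ha 0).trans (hB 0)
  filter_upwards [hC2.isUnit_info, hn.eventually_gt_atTop 0] with k hk hnk i hi
  have hbound : ∀ᵐ ω ∂μ, 0 ≤ B / S.φ * (S.H k i ω).trace ∧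
      ∀ v, S.n k i * ‖v‖ ^ 2 ≤ B / S.φ * (S.H k i ω).trace * gram S k i v := by
    filter_upwards [hk i hi, hC4.φhat_pos k] with ω hunit hφhat
    exact ⟨mul_nonneg (by positivity) (posSemidef_H hφhat.le hφ.le ha).trace_nonneg,
      norm_sq_le_trace_H_mul_gram ha hB (hnk.trans_le (nL_le hi)) hφhat hφ hunit⟩
  obtain ⟨ω, -, hω⟩ := hbound.exists
  exact ⟨le_invMinEig_mul_gram hω, hbound.mono fun ω hω => invMinEig_le hω.1 hω.2⟩

lemma designBound_invMinEig (hmodel : IsGLMM S μ) (hgrowth : Growth S) (hC2 : CondC2 S μ)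
    (hC4 : CondC4 S μ) {B : ℝ} (ha : ∀ η, 0 < iteratedDeriv 2 S.a η)
    (hB : ∀ η, iteratedDeriv 2 S.a η ≤ B) : DesignBound S (invMinEig S) := by
  have hBφ : 0 < B / S.φ := div_pos ((ha 0).trans_le (hB 0)) hmodel.dispersion_pos
  have hL := eventually_invMinEig hmodel hgrowth.nL_tendsto hC2 hC4 (fun η => (ha η).le) hB
  have hL_le := hL.mono fun k hk i hi => (hk i hi).2
  exact
    { nonneg := invMinEig_nonneg
      coercive := hL.mono fun k hk i hi => (hk i hi).1
      bounded := hC2.exists_eventually_le hgrowth.m_tendsto hBφ hL_le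
      mean_bounded := hC2.exists_eventually_mean_le hgrowth invMinEig_nonneg hBφ hL_le
      norm_x_bounded := hC2.exists_norm_x_le }

end Design

section Consistency

variable {p : ℕ} {Ω : Type*} {S : GLMMSeq p Ω} {L : ℕ → ℕ → ℝ}

/-- The mean over the clusters of the quantities `z i`, each scaled by the factor `L k i` with which
it enters the error of cluster `i`. -/
def weightedMean (S : GLMMSeq p Ω) (L : ℕ → ℕ → ℝ) (k : ℕ) (z : ℕ → ℝ) : ℝ :=
  (S.m k : ℝ)⁻¹ * ∑ i : Fin (S.m k), L k i * z i

/-- The error that cluster `i` itself contributes to the estimation of `β + b_i`: the sampling noise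
of its score and the shrinkage of its random effect by the penalty. -/
def clusterNoise (S : GLMMSeq p Ω) (c₀ : ℝ) (k : ℕ) (ω : Ω) (i : ℕ) : ℝ :=
  c₀⁻¹ * ‖meanScore S k i ω‖ + relPenalty S c₀ k ω * ‖S.b i ω‖

lemma weightedMean_clusterNoise (c₀ : ℝ) (k : ℕ) (ω : Ω) :
    weightedMean S L k (clusterNoise S c₀ k ω) =
      c₀⁻¹ * weightedMean S L k (fun i => ‖meanScore S k i ω‖) +
        relPenalty S c₀ k ω * weightedMean S L k fun i => ‖S.b i ω‖ := by
  simp only [weightedMean, clusterNoise, mul_add, Finset.sum_add_distrib, Finset.mul_sum]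
  congr 1 <;> exact Finset.sum_congr rfl fun _ _ => by ring

lemma DesignBound.exists_common_bound (hL : DesignBound S L) (i : ℕ) :
    ∃ M : ℝ, 0 < M ∧ ∀ᶠ k in atTop,
      L k i ≤ M ∧ (S.m k : ℝ)⁻¹ * ∑ i : Fin (S.m k), L k i ≤ M := by
  obtain ⟨C, hC⟩ := hL.bounded i
  obtain ⟨K, hK⟩ := hL.mean_bounded
  refine ⟨max 1 (max C K), lt_max_of_lt_left one_pos, ?_⟩
  filter_upwards [hC, hK] with k hCk hKk
  exact ⟨hCk.trans (by simp), hKk.trans (by simp)⟩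

lemma norm_bhat_sub_b_le {k : ℕ} {ω : Ω} (ha : ContDiff ℝ 2 S.a) {c₀ : ℝ} (hc₀pos : 0 < c₀)
    (hc₀ : ∀ η, c₀ ≤ iteratedDeriv 2 S.a η) (hG : (S.Ghat k ω).PosDef) (hφ : 0 < S.φhat k ω)
    (hmax : IsPQLMax S k ω) (hn : 0 < S.nL k) (hL : ∀ i, 0 ≤ L k i)
    (hgram : ∀ i < S.m k, ∀ v, S.n k i * ‖v‖ ^ 2 ≤ L k i * gram S k i v) {M : ℝ}
    (hρM : relPenalty S c₀ k ω * M ≤ 1 / 2)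
    (hmean : (S.m k : ℝ)⁻¹ * ∑ i : Fin (S.m k), L k i ≤ M) (i : Fin (S.m k)) (hi : L k i ≤ M) :
    ‖S.bhat k ω i - S.b i ω‖ ≤ M * clusterNoise S c₀ k ω i +
      3 * (‖(S.m k : ℝ)⁻¹ • ∑ i : Fin (S.m k), S.b i ω‖ +
        weightedMean S L k (clusterNoise S c₀ k ω)) := by
  have hρ : 0 ≤ relPenalty S c₀ k ω := relPenalty_nonneg hc₀pos.le hφ.le
  have hnoise : 0 ≤ clusterNoise S c₀ k ω i := by unfold clusterNoise; positivity
  have herr (i : Fin (S.m k)) : ‖(S.βhat k ω - S.β) + S.bhat k ω i - S.b i ω‖ ≤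
      L k i * (clusterNoise S c₀ k ω i + relPenalty S c₀ k ω * ‖S.βhat k ω - S.β‖) := by
    have h := norm_combinedError_le ha hc₀pos hc₀ hG hφ hmax hn i (hL i) (hgram i i.2 _)
    rwa [combinedError, ← sub_sub, add_sub_right_comm] at h
  calc ‖S.bhat k ω i - S.b i ω‖
      ≤ L k i * clusterNoise S c₀ k ω i +
        3 * (‖(S.m k : ℝ)⁻¹ • ∑ i : Fin (S.m k), S.b i ω‖ +
          weightedMean S L k (clusterNoise S c₀ k ω)) :=
        norm_sub_le_of_sum_eq_zero (sum_eq_zero_of_isMax hG hmax) herr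
          ((mul_le_mul_of_nonneg_left hmean hρ).trans hρM) i
          ((mul_le_mul_of_nonneg_left hi hρ).trans hρM)
    _ ≤ _ := by gcongr

lemma tendsto_const_div_sqrt_nL (hn : Tendsto S.nL atTop atTop) (c : ℝ) :
    Tendsto (fun k => c / √(S.nL k)) atTop (𝓝 0) :=
  tendsto_const_nhds.div_atTop
    (Real.tendsto_sqrt_atTop.comp (tendsto_natCast_atTop_atTop.comp hn))

variable [MeasurableSpace Ω] {μ : Measure Ω}

lemma measurable_weightedMean {Y : ℕ → Ω → ℝ} (hY : ∀ i, Measurable (Y i)) (k : ℕ) :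
    Measurable fun ω => weightedMean S L k fun i => Y i ω := by
  unfold weightedMean
  fun_prop

lemma eLpNorm_weightedMean_norm_le {E : Type*} [NormedAddCommGroup E] {k : ℕ}
    {Y : ℕ → Ω → E} {K Q : ℝ} (hL : ∀ i, 0 ≤ L k i)
    (hK : (S.m k : ℝ)⁻¹ * ∑ i : Fin (S.m k), L k i ≤ K)
    (hY : ∀ i, AEStronglyMeasurable (Y i) μ) (hQ₀ : 0 ≤ Q)
    (hQ : ∀ i < S.m k, eLpNorm (Y i) 2 μ ≤ ENNReal.ofReal Q) :
    eLpNorm (fun ω => weightedMean S L k fun i => ‖Y i ω‖) 2 μ ≤ ENNReal.ofReal (K * Q) := by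
  have hsum : (fun ω => weightedMean S L k fun i => ‖Y i ω‖) =
      ∑ i : Fin (S.m k), ((S.m k : ℝ)⁻¹ * L k i) • fun ω => ‖Y i ω‖ := by
    ext ω
    simp [weightedMean, Finset.mul_sum, mul_assoc]
  calc eLpNorm (fun ω => weightedMean S L k fun i => ‖Y i ω‖) 2 μ
      ≤ ENNReal.ofReal ((∑ i : Fin (S.m k), (S.m k : ℝ)⁻¹ * L k i) * Q) := by
        rw [hsum]
        exact eLpNorm_two_sum_smul_le (Y := fun (i : Fin (S.m k)) ω => ‖Y i ω‖)
          (fun i _ => mul_nonneg (by positivity) (hL i)) (fun i _ => (hY i).norm)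
          fun i _ => (eLpNorm_norm _).trans_le (hQ i i.2)
    _ ≤ ENNReal.ofReal (K * Q) := by
        rw [← Finset.mul_sum]
        gcongr

lemma boundedInProbability_norm_b (hmodel : IsGLMM S μ) (i : ℕ) :
    BoundedInProbability μ fun _ ω => ‖S.b i ω‖ :=
  boundedInProbability_norm_of_eLpNorm_le (fun _ => (hmodel.measurable_b i).aestronglyMeasurable)
    ENNReal.ofReal_ne_top (Eventually.of_forall fun _ => hmodel.eLpNorm_b_le i)

lemma boundedInProbability_weightedMean_b (hmodel : IsGLMM S μ) (hL : DesignBound S L) :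
    BoundedInProbability μ fun k ω => weightedMean S L k fun i => ‖S.b i ω‖ := by
  obtain ⟨K, hK⟩ := hL.mean_bounded
  have hnorm : BoundedInProbability μ fun k ω => ‖weightedMean S L k fun i => ‖S.b i ω‖‖ := by
    refine boundedInProbability_norm_of_eLpNorm_le (fun k => (measurable_weightedMean
      (fun i => (hmodel.measurable_b i).norm) k).aestronglyMeasurable)
      (ENNReal.ofReal_ne_top (r := K * √S.G.trace)) ?_
    filter_upwards [hK] with k hKk
    exact eLpNorm_weightedMean_norm_le (hL.nonneg k) hKk
      (fun i => (hmodel.measurable_b i).aestronglyMeasurable) (Real.sqrt_nonneg _)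
      fun i _ => hmodel.eLpNorm_b_le i
  exact boundedInProbability_abs_iff.1 hnorm

lemma boundedInProbability_penalty (h : CondC4 S μ) : BoundedInProbability μ (penalty S) :=
  h.φhat_bounded.mul (.sum _ fun l _ => .sum _ fun l' _ =>
    boundedInProbability_abs_iff.2 (h.inv_bounded l l'))

lemma measurable_meanScore (hmodel : IsGLMM S μ) (k i : ℕ) : Measurable (meanScore S k i) :=
  (hmodel.measurable_score k i).const_smul (S.n k i : ℝ)⁻¹

variable [IsProbabilityMeasure μ]

lemma eLpNorm_meanScore_le (hmodel : IsGLMM S μ) (ha : ContDiff ℝ 2 S.a) {B C : ℝ}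
    (hB : ∀ η, iteratedDeriv 2 S.a η ≤ B) {k i : ℕ} (hi : i < S.m k) (hn : 0 < S.nL k)
    (hC : ∀ j < S.n k i, ‖S.x k i j‖ ≤ C) :
    eLpNorm (meanScore S k i) 2 μ ≤ ENNReal.ofReal (√(S.φ * B * C ^ 2) / √(S.nL k)) := by
  have hnL : (0 : ℝ) < S.nL k := by exact_mod_cast hn
  have hle : (S.nL k : ℝ) ≤ S.n k i := by exact_mod_cast nL_le hi
  have hni : (0 : ℝ) < S.n k i := hnL.trans_le hle
  calc eLpNorm (meanScore S k i) 2 μ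
      = ENNReal.ofReal (S.n k i : ℝ)⁻¹ * eLpNorm (score S k i) 2 μ := by
        rw [← Real.enorm_of_nonneg (by positivity), ← eLpNorm_const_smul]
        rfl
    _ ≤ ENNReal.ofReal (S.n k i : ℝ)⁻¹ * ENNReal.ofReal √(S.n k i * (S.φ * B * C ^ 2)) := by
        gcongr
        exact hmodel.eLpNorm_score_le ha hB hi hC
    _ = ENNReal.ofReal (√(S.φ * B * C ^ 2) / √(S.n k i)) := by
        rw [← ENNReal.ofReal_mul (by positivity), Real.sqrt_mul hni.le, ← mul_assoc,
          ← div_eq_inv_mul, Real.sqrt_div_self, ← div_eq_inv_mul]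
    _ ≤ _ := by gcongr

lemma tendstoInMeasure_norm_meanScore (hmodel : IsGLMM S μ) (hm : Tendsto S.m atTop atTop)
    (hn : Tendsto S.nL atTop atTop) (ha : ContDiff ℝ 2 S.a) {B : ℝ}
    (hB : ∀ η, iteratedDeriv 2 S.a η ≤ B) (hL : DesignBound S L) (i : ℕ) :
    TendstoInMeasure μ (fun k ω => ‖meanScore S k i ω‖) atTop fun _ => 0 := by
  obtain ⟨C, hC⟩ := hL.norm_x_bounded
  refine tendstoInMeasure_norm_of_eLpNorm_le
    (fun k => (measurable_meanScore hmodel k i).aestronglyMeasurable) ?_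
    (tendsto_const_div_sqrt_nL hn √(S.φ * B * C ^ 2))
  filter_upwards [hm.eventually_gt_atTop i, hn.eventually_gt_atTop 0] with k hik hnk
  exact eLpNorm_meanScore_le hmodel ha hB hik hnk (hC k i hik)

lemma tendstoInMeasure_weightedMean_meanScore (hmodel : IsGLMM S μ)
    (hn : Tendsto S.nL atTop atTop) (ha : ContDiff ℝ 2 S.a) {B : ℝ}
    (hB : ∀ η, iteratedDeriv 2 S.a η ≤ B) (hL : DesignBound S L) :
    TendstoInMeasure μ (fun k ω => weightedMean S L k fun i => ‖meanScore S k i ω‖) atTop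
      fun _ => 0 := by
  obtain ⟨C, hC⟩ := hL.norm_x_bounded
  obtain ⟨K, hK⟩ := hL.mean_bounded
  refine tendstoInMeasure_zero_of_norm_le (tendstoInMeasure_norm_of_eLpNorm_le (fun k => ?_) ?_
    (by simpa using (tendsto_const_div_sqrt_nL hn √(S.φ * B * C ^ 2)).const_mul K))
    (Eventually.of_forall fun _ _ => le_rfl)
  · exact (measurable_weightedMean
      (fun i => (measurable_meanScore hmodel k i).norm) k).aestronglyMeasurable
  · filter_upwards [hK, hn.eventually_gt_atTop 0] with k hKk hnk
    exact eLpNorm_weightedMean_norm_le (hL.nonneg k) hKk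
      (fun i => (measurable_meanScore hmodel k i).aestronglyMeasurable) (by positivity)
      fun i hi => eLpNorm_meanScore_le hmodel ha hB hi hnk (hC k i hi)

lemma tendstoInMeasure_norm_mean_b (hmodel : IsGLMM S μ) (hm : Tendsto S.m atTop atTop) :
    TendstoInMeasure μ (fun k ω => ‖(S.m k : ℝ)⁻¹ • ∑ i : Fin (S.m k), S.b i ω‖) atTop
      fun _ => 0 := by
  refine tendstoInMeasure_norm_of_eLpNorm_le (q := fun k => √S.G.trace / √(S.m k)) (fun k => ?_) ?_
    (tendsto_const_nhds.div_atTop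
      (Real.tendsto_sqrt_atTop.comp (tendsto_natCast_atTop_atTop.comp hm)))
  · have hsum : Measurable fun ω => ∑ i : Fin (S.m k), S.b i ω :=
      Finset.measurable_fun_sum _ fun i _ => hmodel.measurable_b i
    exact (hsum.const_smul (S.m k : ℝ)⁻¹).aestronglyMeasurable
  · refine Eventually.of_forall fun k => ?_
    calc eLpNorm (fun ω => (S.m k : ℝ)⁻¹ • ∑ i : Fin (S.m k), S.b i ω) 2 μ
        = ENNReal.ofReal (S.m k : ℝ)⁻¹ * eLpNorm (fun ω => ∑ i : Fin (S.m k), S.b i ω) 2 μ := by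
          rw [← Real.enorm_of_nonneg (by positivity), ← eLpNorm_const_smul]
          rfl
      _ ≤ ENNReal.ofReal (S.m k : ℝ)⁻¹ * ENNReal.ofReal √(S.m k * S.G.trace) := by
          gcongr
          exact hmodel.eLpNorm_sum_b_le k
      _ = ENNReal.ofReal (√S.G.trace / √(S.m k)) := by
          rw [← ENNReal.ofReal_mul (by positivity), Real.sqrt_mul (Nat.cast_nonneg _), ← mul_assoc,
            ← div_eq_inv_mul, Real.sqrt_div_self, ← div_eq_inv_mul]

lemma tendstoInMeasure_relPenalty (hC4 : CondC4 S μ) (hn : Tendsto S.nL atTop atTop) {c₀ : ℝ}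
    (hc₀ : 0 < c₀) : TendstoInMeasure μ (relPenalty S c₀) atTop fun _ => 0 :=
  (boundedInProbability_penalty hC4).tendsto_mul
    ((tendsto_natCast_atTop_atTop.comp hn).const_mul_atTop hc₀).inv_tendsto_atTop

lemma tendstoInMeasure_bhatAt (hmodel : IsGLMM S μ) (hPQL : IsPQLEstimator S μ)
    (hm : Tendsto S.m atTop atTop) (hn : Tendsto S.nL atTop atTop) (ha : ContDiff ℝ 2 S.a)
    {c₀ B : ℝ} (hc₀pos : 0 < c₀) (hc₀ : ∀ η, c₀ ≤ iteratedDeriv 2 S.a η)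
    (hB : ∀ η, iteratedDeriv 2 S.a η ≤ B) (hL : DesignBound S L) (hC4 : CondC4 S μ) (i : ℕ) :
    TendstoInMeasure μ (S.bhatAt i) atTop (S.b i) := by
  have hρ := tendstoInMeasure_relPenalty hC4 hn hc₀pos
  have hnoise : TendstoInMeasure μ (fun k ω => clusterNoise S c₀ k ω i) atTop fun _ => 0 :=
    tendstoInMeasure_zero_add (tendstoInMeasure_zero_const_mul _
      (tendstoInMeasure_norm_meanScore hmodel hm hn ha hB hL i))
      (by simpa only [mul_comm] using
        (boundedInProbability_norm_b hmodel i).mul_tendstoInMeasure_zero hρ)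
  have hmean_noise : TendstoInMeasure μ
      (fun k ω => weightedMean S L k (clusterNoise S c₀ k ω)) atTop fun _ => 0 := by
    simp only [weightedMean_clusterNoise]
    exact tendstoInMeasure_zero_add (tendstoInMeasure_zero_const_mul _
      (tendstoInMeasure_weightedMean_meanScore hmodel hn ha hB hL))
      (by simpa only [mul_comm] using
        (boundedInProbability_weightedMean_b hmodel hL).mul_tendstoInMeasure_zero hρ)
  obtain ⟨M, hM, hLM⟩ := hL.exists_common_bound i
  refine tendstoInMeasure_sub_zero_iff.1 (tendstoInMeasure_zero_of_norm_le_of_lt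
    (c := 1 / 2 / M) (by positivity) hρ
    (tendstoInMeasure_zero_add (tendstoInMeasure_zero_const_mul M hnoise)
      (tendstoInMeasure_zero_const_mul 3
        (tendstoInMeasure_zero_add (tendstoInMeasure_norm_mean_b hmodel hm) hmean_noise))) ?_)
  filter_upwards [hLM, hL.coercive, hm.eventually_gt_atTop i, hn.eventually_gt_atTop 0]
    with k hLk hgram hik hnk
  filter_upwards [hPQL.isMax k, hC4.posDef k, hC4.φhat_pos k] with ω hmax hG hφ hsmall
  rw [GLMMSeq.bhatAt, dif_pos hik]
  exact norm_bhat_sub_b_le ha hc₀pos hc₀ hG hφ hmax hnk (hL.nonneg k) hgram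
    ((lt_div_iff₀ hM).1 hsmall).le hLk.2 ⟨i, hik⟩ hLk.1

end Consistency

section Conclusion

variable {p : ℕ}

lemma norm_mulVec_selection_le {ι : Type*} [Fintype ι] {m N : ℕ} {A : Matrix ι (Fin m × Fin p) ℝ}
    {C : ℝ} (hA : ∀ r (i : Fin m) l, |A r (i, l)| ≤ C ∧ (N ≤ (i : ℕ) → A r (i, l) = 0))
    (d : ℕ → Vec p) :
    ‖A *ᵥ fun il => d il.1 il.2‖ ≤ |C| * p * ∑ i ∈ Finset.range N, ‖d i‖ := by
  have hcluster (r : ι) (i : Fin m) :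
      ‖∑ l, A r (i, l) * d i l‖ ≤ if (i : ℕ) < N then |C| * p * ‖d i‖ else 0 := by
    split_ifs with hi
    · calc ‖∑ l, A r (i, l) * d i l‖ ≤ ∑ _l : Fin p, |C| * ‖d i‖ := by
            refine norm_sum_le_of_le _ fun l _ => ?_
            rw [norm_mul]
            exact mul_le_mul ((hA r i l).1.trans (le_abs_self C)) (PiLp.norm_apply_le _ l)
              (norm_nonneg _) (abs_nonneg C)
        _ = |C| * p * ‖d i‖ := by
            rw [Fin.sum_const, nsmul_eq_mul]
            ring
    · simp [fun l => (hA r i l).2 (not_lt.1 hi)]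
  refine (pi_norm_le_iff_of_nonneg (by positivity)).2 fun r => ?_
  calc ‖(A *ᵥ fun il => d il.1 il.2) r‖ = ‖∑ i : Fin m, ∑ l, A r (i, l) * d i l‖ := by
        simp only [Matrix.mulVec, dotProduct, Fintype.sum_prod_type]
    _ ≤ ∑ i : Fin m, if (i : ℕ) < N then |C| * p * ‖d i‖ else 0 :=
        norm_sum_le_of_le _ fun i _ => hcluster r i
    _ = ∑ i ∈ Finset.range m with i < N, |C| * p * ‖d i‖ := by
        rw [Fin.sum_univ_eq_sum_range (fun i => if i < N then |C| * p * ‖d i‖ else 0) m,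
          Finset.sum_filter]
    _ ≤ ∑ i ∈ Finset.range N, |C| * p * ‖d i‖ :=
        Finset.sum_le_sum_of_subset_of_nonneg
          (fun i hi => Finset.mem_range.2 (Finset.mem_filter.1 hi).2) fun _ _ _ => by positivity
    _ = |C| * p * ∑ i ∈ Finset.range N, ‖d i‖ := (Finset.mul_sum _ _ _).symm

lemma FiniteSelection.exists_bound {q : ℕ} {m : ℕ → ℕ}
    {A : (k : ℕ) → Matrix (Fin q) (Fin (m k) × Fin p) ℝ} (hA : FiniteSelection m A)
    (hm : Tendsto m atTop atTop) : ∃ (N : ℕ) (C : ℝ), ∀ᶠ k in atTop,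
      ∀ r (i : Fin (m k)) l, |A k r (i, l)| ≤ C ∧ (N ≤ (i : ℕ) → A k r (i, l) = 0) := by
  choose m₀ hm₀ using hA.finite
  choose Lim hLim using hA.limit
  set N := ∑ r, m₀ r
  have hle (r : Fin q) : m₀ r ≤ N :=
    Finset.single_le_sum (fun _ _ => Nat.zero_le _) (Finset.mem_univ r)
  have hentries : Tendsto (fun k (e : Fin q × Fin N × Fin p) =>
      if h : (e.2.1 : ℕ) < m k then A k e.1 (⟨e.2.1, h⟩, e.2.2) else 0) atTop
      (𝓝 fun e => Lim e.1 e.2.1 e.2.2) :=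
    tendsto_pi_nhds.2 fun e => hLim e.1 e.2.1 e.2.2
  obtain ⟨C, hC⟩ := hentries.norm.isBoundedUnder_le
  rw [eventually_map] at hC
  refine ⟨N, C, ?_⟩
  filter_upwards [hC, hm.eventually_gt_atTop N] with k hCk hmk r i l
  have hzero (hi : N ≤ i) : A k r (i, l) = 0 :=
    hm₀ r k ((hle r).trans_lt hmk) i ((hle r).trans hi) l
  refine ⟨?_, hzero⟩
  rcases lt_or_ge (i : ℕ) N with hi | hi
  · simpa using (norm_le_pi_norm _ (r, ⟨i, hi⟩, l)).trans hCk
  · simpa [hzero hi] using (norm_nonneg _).trans hCk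

variable {Ω : Type*} [MeasurableSpace Ω] {μ : Measure Ω}

lemma tendstoInMeasure_sum_norm_sub {ι E : Type*} [SeminormedAddCommGroup E] {s : Finset ι}
    {f : ι → ℕ → Ω → E} {g : ι → Ω → E} (h : ∀ i ∈ s, TendstoInMeasure μ (f i) atTop (g i)) :
    TendstoInMeasure μ (fun k ω => ∑ i ∈ s, ‖f i k ω - g i ω‖) atTop fun _ => 0 := by
  have hnorm (i) (hi : i ∈ s) :
      TendstoInMeasure μ (fun k ω => ‖f i k ω - g i ω‖) atTop fun _ => 0 := by
    simpa [tendstoInMeasure_iff_norm] using h i hi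
  simpa using tendstoInMeasure_sum s hnorm

lemma tendstoInMeasure_pi {ι E : Type*} [Fintype ι] [SeminormedAddCommGroup E]
    {f : ι → ℕ → Ω → E} {g : ι → Ω → E} (h : ∀ i, TendstoInMeasure μ (f i) atTop (g i)) :
    TendstoInMeasure μ (fun k ω i => f i k ω) atTop fun ω i => g i ω := by
  refine tendstoInMeasure_sub_zero_iff.1 (tendstoInMeasure_zero_of_norm_le
    (tendstoInMeasure_sum_norm_sub (s := Finset.univ) fun i _ => h i)
    (Eventually.of_forall fun k ω => ?_))
  exact (pi_norm_le_iff_of_nonneg (by positivity)).2 fun i =>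
    Finset.single_le_sum (f := fun i => ‖f i k ω - g i ω‖) (fun _ _ => norm_nonneg _)
      (Finset.mem_univ i)

lemma measurable_bhatAt {S : GLMMSeq p Ω} (hPQL : IsPQLEstimator S μ) (i k : ℕ) :
    Measurable (S.bhatAt i k) := by
  unfold GLMMSeq.bhatAt
  split_ifs with hi
  · exact (measurable_pi_apply _).comp (hPQL.measurable_bhat k)
  · exact measurable_const

end Conclusion

end PQL

end

theorem theorem3_general {p q : ℕ} {Ω : Type*} [MeasurableSpace Ω] (μ : Measure Ω)
    [IsProbabilityMeasure μ] (S : PQL.GLMMSeq p Ω) (hmodel : PQL.IsGLMM S μ)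
    (hPQL : PQL.IsPQLEstimator S μ) (hm : Tendsto S.m atTop atTop)
    (hn : Tendsto S.nL atTop atTop) (ha : ContDiff ℝ 2 S.a) {c₀ B : ℝ} (hc₀pos : 0 < c₀)
    (hc₀ : ∀ η, c₀ ≤ iteratedDeriv 2 S.a η) (hB : ∀ η, iteratedDeriv 2 S.a η ≤ B)
    {L : ℕ → ℕ → ℝ} (hL : PQL.DesignBound S L) (hC4 : PQL.CondC4 S μ)
    (A : (k : ℕ) → Matrix (Fin q) (Fin (S.m k) × Fin p) ℝ) {N : ℕ} {C : ℝ}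
    (hA : ∀ᶠ k in atTop,
      ∀ r (i : Fin (S.m k)) l, |A k r (i, l)| ≤ C ∧ (N ≤ (i : ℕ) → A k r (i, l) = 0)) :
    TendstoInMeasure μ
      (fun k ω => A k *ᵥ fun il => (S.bhat k ω il.1 - S.bTrue k ω il.1) il.2) atTop
      (fun _ => (0 : Fin q → ℝ)) ∧
    (∀ i : ℕ, TendstoInDistribution (S.bhatAt i) atTop (S.b i) (fun _ => μ) μ) ∧
    (∀ s : Finset ℕ, TendstoInDistribution (fun k ω (i : s) => S.bhatAt i k ω) atTop
      (fun ω (i : s) => S.b i ω) (fun _ => μ) μ) := by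
  have hcons := PQL.tendstoInMeasure_bhatAt hmodel hPQL hm hn ha hc₀pos hc₀ hB hL hC4
  refine ⟨?_, fun i => ?_, fun s => ?_⟩
  · have herror := PQL.tendstoInMeasure_zero_const_mul (|C| * p)
      (PQL.tendstoInMeasure_sum_norm_sub (s := Finset.range N) fun i _ => hcons i)
    refine PQL.tendstoInMeasure_zero_of_norm_le herror (hA.mono fun k hk ω => ?_)
    simpa [PQL.GLMMSeq.bhatAt, PQL.GLMMSeq.bTrue] using
      PQL.norm_mulVec_selection_le hk fun i => S.bhatAt i k ω - S.b i ω
  · exact (hcons i).tendstoInDistribution fun k => (PQL.measurable_bhatAt hPQL i k).aemeasurable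
  · exact (PQL.tendstoInMeasure_pi fun i : s => hcons i).tendstoInDistribution fun k =>
      (measurable_pi_lambda _ fun i : s => PQL.measurable_bhatAt hPQL i k).aemeasurable

theorem theorem3 {p q : ℕ} {Ω : Type*} [MeasurableSpace Ω] (μ : Measure Ω) [IsProbabilityMeasure μ]
    (S : PQL.GLMMSeq p Ω) (hmodel : PQL.IsGLMM S μ) (hPQL : PQL.IsPQLEstimator S μ)
    (hgrowth : PQL.Growth S)
    (hrate : Tendsto (fun k => (S.m k : ℝ) / (S.nL k : ℝ) ^ 2) atTop (𝓝 0))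
    (hC1 : PQL.CondC1 S) (hC2 : PQL.CondC2 S μ) (hC3 : PQL.CondC3 S μ) (hC4 : PQL.CondC4 S μ)
    (hC5 : PQL.CondC5 S μ)
    (A : (k : ℕ) → Matrix (Fin q) (Fin (S.m k) × Fin p) ℝ) (hA : PQL.FiniteSelection S.m A) :
    TendstoInMeasure μ
      (fun k ω => A k *ᵥ fun il => (S.bhat k ω il.1 - S.bTrue k ω il.1) il.2) atTop
      (fun _ => (0 : Fin q → ℝ)) ∧
    (∀ i : ℕ, TendstoInDistribution (S.bhatAt i) atTop (S.b i) (fun _ => μ) μ) ∧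
    (∀ s : Finset ℕ, TendstoInDistribution (fun k ω (i : s) => S.bhatAt i k ω) atTop
      (fun ω (i : s) => S.b i ω) (fun _ => μ) μ) := by
  obtain ⟨ha, c₀, hc₀, hbound⟩ := hC1
  obtain ⟨N, C, hAb⟩ := hA.exists_bound hgrowth.m_tendsto
  exact theorem3_general μ S hmodel hPQL hgrowth.m_tendsto hgrowth.nL_tendsto
    (ha.of_le (by norm_num)) hc₀ (fun η => (hbound η).1) (fun η => (hbound η).2.1)
    (PQL.designBound_invMinEig hmodel hgrowth hC2 hC4 (fun η => hc₀.trans_le (hbound η).1)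
      fun η => (hbound η).2.1) hC4 A hAb
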